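/- Write $\mathbb{I}=[0,1]$ and let $\lambda$ be Lebesgue measure. **Univariate measures.** A measure $\nu$ on $[0,\infty)$ or on $\mathbb{I}$ is *absolutely continuous* if $\nu\ll\lambda$, *discrete* if it is concentrated on a countable set, and *singular* if it has no point masses and is concentrated on a Borel set $G$ with $\lambda(G)=0$. **Archimax copulas.** Let $\gamma$ be a probability measure on $[0,\infty)$ with $\gamma(\{0\})=0$ (a Williamson measure), and let $\vartheta$ be a probability measure on $\mathbb{I}$ with $\int_{\mathbb{I}} s\,\mathrm{d}\vartheta(s)=\tfrac12$ (a Pickands dependence measure). Put $$\psi(z)=\int_{[0,\infty)}\max\{1-tz,0\}\,\mathrm{d}\gamma(t)\quad(z\ge 0),\qquad \varphi(y)=\inf\{z\ge 0:\psi(z)=y\}\quad(0<y<1),$$ $$A(t)=1-t+2\int_{[0,t]}\vartheta([0,z])\,\mathrm{d}\lambda(z)\quad(t\in\mathbb{I}).$$ The Archimax copula $C=C_{\gamma,\vartheta}$ of $\gamma$ and $\vartheta$ is the copula given by $$C(x,y)=\psi\left((\varphi(x)+\varphi(y))\,A\left(\frac{\varphi(x)}{\varphi(x)+\varphi(y)}\right)\right)\qquad\text{for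 }(x,y)\in(0,1)^2,$$ and by the boundary values common to all copulas, $C(x,0)=C(0,x)=0$ and $C(x,1)=C(1,x)=x$. **Regularity of copulas.** For a copula $C$ let $\mu_C$ be the probability measure on $\mathbb{I}^2$ with $\mu_C([0,x]\times[0,y])=C(x,y)$, and let $K_C$ be (a version of) its Markov kernel, i.e. the regular conditional distribution of the second coordinate given the first, so that $\mu_C(E\times F)=\int_E K_C(x,F)\,\mathrm{d}\lambda(x)$. Decompose each $K_C(x,\cdot)=K_C^{abs}(x,\cdot)+K_C^{dis}(x,\cdot)+K_C^{sing}(x,\cdot)$ into its absolutely continuous, discrete and singular (without point masses) parts with respect to $\lambda$, and for $\ast\in\{abs,dis,sing\}$ let $\mu_C^{\ast}$ be the measure on $\mathbb{I}^2$ with $\mu_C^{\ast}(E\times F)=\int_E K_C^{\ast}(x,F)\,\mathrm{d}\lambda(x)$. The copula $C$ is called *absolutely continuous*, *discrete* or *singular* if $\mu_C^{abs}(\mathbb{I}^2)=1$, $\mu_C^{dis}(\mathbb{I}^2)=1$ or $\mu_C^{sing}(\mathbb{I}^2)=1$, respectively. **Theorem.** Let $\gamma$ be a Williamson measure, $\vartheta$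 a Pickands dependence measure and $C=C_{\gamma,\vartheta}$ their Archimax copula. 1. If $\gamma$ and $\vartheta$ are absolutely continuous, then $C$ is an absolutely continuous copula. 2. If $\gamma$ and $\vartheta$ are discrete and $\vartheta(\{0\})=0=\vartheta(\{1\})$, then $C$ is a discrete copula. 3. If $\gamma$ and $\vartheta$ are singular, then $C$ is a singular copula. -/

import Mathlib

open MeasureTheory ProbabilityTheory Set
open scoped unitInterval ENNReal

noncomputable section

namespace Archimax

/-! ### Discrete and singular measures -/

/-- `ν` is discrete: it is concentrated on a countable set. -/
def IsDiscrete {S : Type*} [MeasurableSpace S] (ν : Measure S) : Prop :=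
  ∃ D : Set S, D.Countable ∧ ν Dᶜ = 0

/-- `ν` is singular (without point masses): it has no atoms and is concentrated on a
Borel set of Lebesgue measure zero. -/
def IsSingular {S : Type*} [MeasureSpace S] (ν : Measure S) : Prop :=
  (∀ s : S, ν {s} = 0) ∧ ∃ G : Set S, MeasurableSet G ∧ volume G = 0 ∧ ν Gᶜ = 0

/-! ### Williamson measures and generators -/

/-- A Williamson measure: a probability measure on `[0, ∞)` without mass in `0`, regarded as a
measure on the real line that gives no mass to `(-∞, 0]`. -/
structure IsWilliamsonMeasure (γ : Measure ℝ) : Prop where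
  isProbabilityMeasure : IsProbabilityMeasure γ
  measure_Iic_zero : γ (Iic 0) = 0

/-- The generator `ψ(z) = ∫ (1 - t z)₊ dγ(t)` on `[0, ∞)` induced by `γ`. -/
def generator (γ : Measure ℝ) (z : ℝ) : ℝ :=
  ∫ t, max (1 - t * z) 0 ∂γ

/-- The pseudo-inverse `φ(y) = inf {z ≥ 0 : ψ(z) = y}` of the generator; it is only evaluated
at points `y ∈ (0, 1)`, where it is finite. -/
def pseudoInverse (γ : Measure ℝ) (y : ℝ) : ℝ :=
  sInf {z : ℝ | 0 ≤ z ∧ generator γ z = y}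

/-! ### Pickands dependence measures and functions -/

/-- A Pickands dependence measure: a probability measure on `[0, 1]` with expectation `1 / 2`. -/
structure IsPickandsMeasure (ϑ : Measure I) : Prop where
  isProbabilityMeasure : IsProbabilityMeasure ϑ
  integral_eq : ∫ s : I, (s : ℝ) ∂ϑ = 1 / 2

/-- The Pickands dependence function `A(t) = 1 - t + 2 ∫_[0,t] ϑ([0,z]) dz`, `t ∈ [0, 1]`. -/
def pickandsFunction (ϑ : Measure I) (t : ℝ) : ℝ :=
  1 - t + 2 * ∫ z in (0 : ℝ)..t, ϑ.real {s : I | (s : ℝ) ≤ z}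

/-! ### Copulas and their doubly stochastic measures -/

/-- A bivariate copula: grounded, with uniform margins, and `2`-increasing. -/
structure IsCopula (C : I → I → ℝ) : Prop where
  zero_left : ∀ y, C 0 y = 0
  zero_right : ∀ x, C x 0 = 0
  one_left : ∀ y, C 1 y = y
  one_right : ∀ x, C x 1 = x
  two_increasing : ∀ x x' y y', x ≤ x' → y ≤ y' → 0 ≤ C x' y' - C x y' - C x' y + C x y

/-- `μ([0,x] × [0,y]) = C(x,y)` for all `x, y ∈ [0, 1]`. -/
def IsCopulaMeasure (C : I → I → ℝ) (μ : Measure (I × I)) : Prop :=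
  ∀ x y : I, μ (Iic x ×ˢ Iic y) = ENNReal.ofReal (C x y)

lemma IsCopulaMeasure.isFiniteMeasure {C : I → I → ℝ} {μ : Measure (I × I)}
    (h : IsCopulaMeasure C μ) : IsFiniteMeasure μ := by
  refine ⟨?_⟩
  have h1 : (univ : Set (I × I)) = Iic 1 ×ˢ Iic 1 := by
    ext p
    simp only [mem_univ, mem_prod, mem_Iic, true_iff]
    exact ⟨unitInterval.le_one', unitInterval.le_one'⟩
  rw [h1, h 1 1]
  exact ENNReal.ofReal_lt_top

lemma IsCopulaMeasure.unique {C : I → I → ℝ} {μ ν : Measure (I × I)}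
    (hμ : IsCopulaMeasure C μ) (hν : IsCopulaMeasure C ν) : μ = ν := by
  have := hμ.isFiniteMeasure
  have := hν.isFiniteMeasure
  have hspan : IsCountablySpanning (range (Iic : I → Set I)) :=
    ⟨fun _ => univ, fun _ => ⟨1, by ext; simp [unitInterval.le_one']⟩, iUnion_const _⟩
  have hgen : MeasurableSpace.generateFrom (range (Iic : I → Set I)) =
      (inferInstance : MeasurableSpace I) := (borel_eq_generateFrom_Iic I).symm.trans
    (BorelSpace.measurable_eq).symm
  have hprod := generateFrom_eq_prod hgen hgen hspan hspan
  refine ext_of_generate_finite _ hprod.symm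
    (IsPiSystem.prod (isPiSystem_Iic) (isPiSystem_Iic)) ?_ ?_
  · rintro _ ⟨_, ⟨x, rfl⟩, _, ⟨y, rfl⟩, rfl⟩
    rw [hμ x y, hν x y]
  · have h1 : (univ : Set (I × I)) = Iic 1 ×ˢ Iic 1 := by
      ext p
      simp only [mem_univ, mem_prod, mem_Iic, true_iff]
      exact ⟨unitInterval.le_one', unitInterval.le_one'⟩
    rw [h1, hμ 1 1, hν 1 1]

open scoped Classical in
/-- The doubly stochastic measure `μ_C` of a copula `C`: the unique measure with
`μ_C([0,x] × [0,y]) = C(x,y)`. -/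
def copulaMeasure (C : I → I → ℝ) : Measure (I × I) :=
  if h : ∃ μ, IsCopulaMeasure C μ then h.choose else 0

lemma IsCopulaMeasure.copulaMeasure_eq {C : I → I → ℝ} {μ : Measure (I × I)}
    (h : IsCopulaMeasure C μ) : copulaMeasure C = μ := by
  have hex : ∃ μ, IsCopulaMeasure C μ := ⟨μ, h⟩
  rw [copulaMeasure, dif_pos hex]
  exact hex.choose_spec.unique h

instance (C : I → I → ℝ) : IsFiniteMeasure (copulaMeasure C) := by
  by_cases h : ∃ μ, IsCopulaMeasure C μ
  · obtain ⟨μ, hμ⟩ := h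
    rw [hμ.copulaMeasure_eq]
    exact hμ.isFiniteMeasure
  · rw [copulaMeasure, dif_neg h]
    infer_instance

/-- (A version of) the Markov kernel `K_C` of `C`: the regular conditional distribution of the
second coordinate given the first one under `μ_C`. -/
def markovKernel (C : I → I → ℝ) : Kernel I I :=
  (copulaMeasure C).condKernel

instance (C : I → I → ℝ) : IsMarkovKernel (markovKernel C) := by
  unfold markovKernel; infer_instance

/-! ### Decomposition of measures and kernels on the unit interval -/

/-- The absolutely continuous component of a measure on `[0, 1]`. -/
def absPart (ν : Measure I) : Measure I :=
  (volume : Measure I).withDensity (ν.rnDeriv volume)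

/-- The discrete component: the restriction to the set of point masses. -/
def disPart (ν : Measure I) : Measure I :=
  ν.restrict {y | ν {y} ≠ 0}

/-- The singular component without point masses: what the Lebesgue singular part puts off the
set of point masses. -/
def singPart (ν : Measure I) : Measure I :=
  (ν.singularPart volume).restrict {y | ν {y} = 0}

lemma measurable_atom (K : Kernel I I) [IsFiniteKernel K] :
    Measurable fun p : I × I => K p.1 {p.2} := by
  have hd : MeasurableSet {q : (I × I) × I | q.2 = q.1.2} :=
    measurableSet_eq_fun measurable_snd (measurable_snd.comp measurable_fst)
  have h := Kernel.measurable_kernel_prodMk_left (κ := K.prodMkRight I) hd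
  simpa [Kernel.prodMkRight_apply, preimage] using h

/-- Restricting a kernel to a section-wise varying measurable set gives measurable mass. -/
lemma measurable_restrict_section (K : Kernel I I) [IsFiniteKernel K] {E : Set (I × I)}
    (hE : MeasurableSet E) : Measurable fun x => (K x).restrict {y | (x, y) ∈ E} := by
  refine Measure.measurable_of_measurable_coe _ fun s hs => ?_
  have h := Kernel.measurable_kernel_prodMk_left (κ := K)
    ((measurable_snd hs : MeasurableSet {p : I × I | p.2 ∈ s}).inter hE)
  convert h using 2 with x
  rw [Measure.restrict_apply hs]
  rfl

/-- The absolutely continuous sub-kernel of a kernel. -/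
def absKernel (K : Kernel I I) [IsFiniteKernel K] : Kernel I I where
  toFun x := absPart (K x)
  measurable' := by
    have h : (fun x => absPart (K x)) =
        Kernel.withDensity (Kernel.const I (volume : Measure I))
          (Kernel.rnDeriv K (Kernel.const I volume)) := by
      funext x
      rw [Kernel.withDensity_apply _ (Kernel.measurable_rnDeriv _ _), absPart]
      exact (withDensity_congr_ae (Kernel.rnDeriv_eq_rnDeriv_measure (κ := K)
        (η := Kernel.const I volume) (a := x))).symm
    rw [h]
    exact Kernel.measurable _

/-- The discrete sub-kernel of a kernel. -/
def disKernel (K : Kernel I I) [IsFiniteKernel K] : Kernel I I where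
  toFun x := disPart (K x)
  measurable' :=
    measurable_restrict_section K (E := {p | K p.1 {p.2} ≠ 0})
      (measurable_atom K (measurableSet_singleton 0).compl)

/-- The singular sub-kernel of a kernel. -/
def singKernel (K : Kernel I I) [IsFiniteKernel K] : Kernel I I where
  toFun x := singPart (K x)
  measurable' := by
    have h := measurable_restrict_section (Kernel.singularPart K (Kernel.const I volume))
      (E := {p | K p.1 {p.2} = 0}) (measurable_atom K (measurableSet_singleton 0))
    convert h using 2 with x
    rw [Kernel.singularPart_eq_singularPart_measure]
    rfl

lemma isFiniteKernel_of_le {K L : Kernel I I} [IsFiniteKernel K] (h : ∀ x, L x ≤ K x) :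
    IsFiniteKernel L :=
  ⟨⟨K.bound, K.bound_lt_top, fun x => (h x univ).trans (K.measure_le_bound x univ)⟩⟩

instance (K : Kernel I I) [IsFiniteKernel K] : IsFiniteKernel (absKernel K) :=
  isFiniteKernel_of_le (K := K) fun x => Measure.withDensity_rnDeriv_le (K x) volume

instance (K : Kernel I I) [IsFiniteKernel K] : IsFiniteKernel (disKernel K) :=
  isFiniteKernel_of_le (K := K) fun _ => Measure.restrict_le_self

instance (K : Kernel I I) [IsFiniteKernel K] : IsFiniteKernel (singKernel K) :=
  isFiniteKernel_of_le (K := K) fun x =>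
    Measure.restrict_le_self.trans (Measure.singularPart_le (K x) volume)

/-! ### Components of a copula -/

/-- `μ_C^abs(E × F) = ∫_E K_C^abs(x, F) dx`. -/
def absComponent (C : I → I → ℝ) : Measure (I × I) :=
  (volume : Measure I) ⊗ₘ absKernel (markovKernel C)

/-- `μ_C^dis(E × F) = ∫_E K_C^dis(x, F) dx`. -/
def disComponent (C : I → I → ℝ) : Measure (I × I) :=
  (volume : Measure I) ⊗ₘ disKernel (markovKernel C)

/-- `μ_C^sing(E × F) = ∫_E K_C^sing(x, F) dx`. -/
def singComponent (C : I → I → ℝ) : Measure (I × I) :=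
  (volume : Measure I) ⊗ₘ singKernel (markovKernel C)

/-- `C` is an absolutely continuous copula. -/
def IsAbsolutelyContinuousCopula (C : I → I → ℝ) : Prop :=
  IsCopula C ∧ absComponent C univ = 1

/-- `C` is a discrete copula. -/
def IsDiscreteCopula (C : I → I → ℝ) : Prop :=
  IsCopula C ∧ disComponent C univ = 1

/-- `C` is a singular copula. -/
def IsSingularCopula (C : I → I → ℝ) : Prop :=
  IsCopula C ∧ singComponent C univ = 1

/-! ### Archimax copulas -/

open scoped Classical in
/-- The Archimax copula `C_{γ,ϑ}`: on `(0,1)²` it is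
`ψ((φ(x) + φ(y)) A(φ(x) / (φ(x) + φ(y))))`; on the boundary of the unit square it takes the
values `min x y`, which are those of every copula. -/
def archimaxCopula (γ : Measure ℝ) (ϑ : Measure I) (x y : I) : ℝ :=
  if (x : ℝ) ∈ Ioo (0 : ℝ) 1 ∧ (y : ℝ) ∈ Ioo (0 : ℝ) 1 then
    generator γ ((pseudoInverse γ x + pseudoInverse γ y) *
      pickandsFunction ϑ (pseudoInverse γ x / (pseudoInverse γ x + pseudoInverse γ y)))
  else min (x : ℝ) y

end Archimax

end

/-! By homogeneity, `C(x,y) = ψ(ℓ(φ(x), φ(y)))` with `ℓ(z,w) = 2 ∫ max (z(1-s)) (ws) dϑ(s)`.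
Formally, `-∂/∂z ψ(ℓ(z,w))` is the product of `∫ t 1{t ℓ(z,w) ≤ 1} dγ(t)` and `∂ℓ/∂z = ∫ 2(1-s) 1{sw
≤ z(1-s)} dϑ(s)`. A product of this form is the mass of an event under a product measure. So, given
that the first coordinate is `ψ(z)`, the second one should be `ψ(W)`, where `(t,s)` has density
proportional to `t 1{tz<1} · 2(1-s)` with respect to `γ ⊗ ϑ` and `W` is the largest `w` with `t
ℓ(z,w) ≤ 1` and `sw ≤ z(1-s)`. Nothing is differentiated: integrating this candidate over `z` gives
back `C` (`lintegral_levelPoint`, `lintegral_conditionalMeasure`, `isCopulaMeasure_compProd`), and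
uniqueness of disintegrations identifies it with the Markov kernel (`markovKernel_archimaxCopula`).

At `W` one constraint is an equality, so `t = 1/ℓ(z,W)` or `s = z/(z+W)`. The functions `ℓ(z,·)`,
`1/w`, `z/(z+w)` and `ψ` are convex and, on the regions that matter, strictly monotone. They are
therefore locally Lipschitz with locally Lipschitz inverses, and they carry null sets, countable
sets and points to sets of the same kind in both directions. Hence a regularity type shared by `γ`
and `ϑ` passes to the conditional laws.

The one obstruction is that `ψ` may vanish on a half-line and collapse it to the value `0`. Since
the second margin is uniform, almost every conditional law has no mass there
(`archimaxKernel_singleton_zero`). -/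

noncomputable section

namespace Archimax

/-! ### Null sets under convex functions -/

open scoped Topology in
/-- The image of a null set under a locally Lipschitz function on the line is a null set. -/
lemma volume_image_eq_zero_of_locallyLipschitzOn {f : ℝ → ℝ} {s N : Set ℝ}
    (hf : LocallyLipschitzOn s f) (hs : N ⊆ s) (hN : volume N = 0) : volume (f '' N) = 0 := by
  have h : ∀ x ∈ s, ∃ u ∈ 𝓝[s] x, ∃ K, LipschitzOnWith K f u := fun x hx => by
    obtain ⟨K, u, hu, hK⟩ := hf hx
    exact ⟨u, hu, K, hK⟩
  choose! u hu K hK using h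
  obtain ⟨t, hts, htc, hcov⟩ := TopologicalSpace.countable_cover_nhdsWithin hu
  have hsub : f '' N ⊆ ⋃ x ∈ t, f '' (N ∩ u x) := by
    rintro _ ⟨y, hy, rfl⟩
    obtain ⟨x, hx, hyx⟩ := mem_iUnion₂.1 (hcov (hs hy))
    exact mem_iUnion₂.2 ⟨x, hx, y, ⟨hy, hyx⟩, rfl⟩
  refine measure_mono_null hsub ((measure_biUnion_null_iff htc).2 fun x hx => ?_)
  -- Lebesgue measure on the line is one-dimensional Hausdorff measure, which a Lipschitz map
  -- enlarges at most by its constant.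
  have h1 := ((hK x (hts hx)).mono inter_subset_right).hausdorffMeasure_image_le
    (s := N ∩ u x) (d := 1) zero_le_one
  rw [hausdorffMeasure_real, measure_mono_null inter_subset_left hN, mul_zero] at h1
  exact le_antisymm h1 bot_le

open scoped Topology in
/-- The preimage of a null set under a function on the line that is locally bounded below by a
linear function is a null set. -/
lemma volume_preimage_eq_zero_of_locally_expanding {f : ℝ → ℝ} {s N : Set ℝ}
    (hf : ∀ x ∈ s, ∃ u ∈ 𝓝[s] x, ∃ c > 0, ∀ a ∈ u, ∀ b ∈ u, c * |a - b| ≤ |f a - f b|)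
    (hN : volume N = 0) : volume (s ∩ f ⁻¹' N) = 0 := by
  choose! u hu c hc hexp using hf
  obtain ⟨t, hts, htc, hcov⟩ := TopologicalSpace.countable_cover_nhdsWithin hu
  have hsub : s ∩ f ⁻¹' N ⊆ ⋃ x ∈ t, (u x ∩ f ⁻¹' N) := by
    rintro y ⟨hy, hyN⟩
    obtain ⟨x, hx, hyx⟩ := mem_iUnion₂.1 (hcov hy)
    exact mem_iUnion₂.2 ⟨x, hx, hyx, hyN⟩
  refine measure_mono_null hsub ((measure_biUnion_null_iff htc).2 fun x hx => ?_)
  have hx' := hts hx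
  have hinj : InjOn f (u x) := fun a ha b hb hab => by
    have := hexp x hx' a ha b hb
    rw [hab, sub_self, abs_zero] at this
    have := nonpos_of_mul_nonpos_right this (hc x hx')
    exact sub_eq_zero.1 (abs_nonpos_iff.1 this)
  -- The lower bound makes the local inverse Lipschitz with constant `1/c`, so it maps null sets to
  -- null sets.
  set g := Function.invFunOn f (u x)
  have hg : ∀ a ∈ u x, g (f a) = a := fun a ha => hinj.leftInvOn_invFunOn ha
  have hlip : LipschitzOnWith (Real.toNNReal (c x)⁻¹) g (f '' (u x)) := by
    refine LipschitzOnWith.of_dist_le_mul ?_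
    rintro _ ⟨a, ha, rfl⟩ _ ⟨b, hb, rfl⟩
    rw [hg a ha, hg b hb, Real.dist_eq, Real.dist_eq,
      Real.coe_toNNReal _ (inv_nonneg.2 (hc x hx').le), le_inv_mul_iff₀ (hc x hx')]
    exact hexp x hx' a ha b hb
  have himg : u x ∩ f ⁻¹' N ⊆ g '' (f '' u x ∩ N) := fun a ha =>
    ⟨f a, ⟨⟨a, ha.1, rfl⟩, ha.2⟩, hg a ha.1⟩
  have h1 := (hlip.mono inter_subset_left).hausdorffMeasure_image_le
    (s := f '' u x ∩ N) (d := 1) zero_le_one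
  rw [hausdorffMeasure_real, measure_mono_null inter_subset_right hN, mul_zero] at h1
  exact measure_mono_null himg (le_antisymm h1 bot_le)

lemma volume_image_eq_zero_of_convexOn {f : ℝ → ℝ} {s N : Set ℝ} (hs : IsOpen s)
    (hf : ConvexOn ℝ s f) (hN : N ⊆ s) (h0 : volume N = 0) : volume (f '' N) = 0 :=
  volume_image_eq_zero_of_locallyLipschitzOn (hf.locallyLipschitzOn hs) hN h0

/-- Slopes of a convex function increase, so to the right of a chord of positive slope the function
expands distances at least by that slope. -/
lemma volume_preimage_eq_zero_of_strictMonoOn {f : ℝ → ℝ} {s N : Set ℝ} (hs : IsOpen s)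
    (hf : ConvexOn ℝ s f) (hmono : StrictMonoOn f s) (hN : volume N = 0) :
    volume (s ∩ f ⁻¹' N) = 0 := by
  refine volume_preimage_eq_zero_of_locally_expanding (fun x hx => ?_) hN
  obtain ⟨ε, hε, hball⟩ := Metric.isOpen_iff.1 hs x hx
  rw [Real.ball_eq_Ioo] at hball
  have hp : x - ε / 2 ∈ s := hball ⟨by linarith, by linarith⟩
  have hq : x - ε / 4 ∈ s := hball ⟨by linarith, by linarith⟩
  have hlt : f (x - ε / 2) < f (x - ε / 4) := hmono hp hq (by linarith)
  -- The expansion constant is the slope of the chord over `[x - ε/2, x - ε/4]`, which lies to the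
  -- left of the chosen neighbourhood.
  refine ⟨Ioo (x - ε / 4) (x + ε), mem_nhdsWithin_of_mem_nhds (Ioo_mem_nhds (by linarith)
    (by linarith)), (f (x - ε / 4) - f (x - ε / 2)) / (x - ε / 4 - (x - ε / 2)),
    div_pos (by linarith) (by linarith), ?_⟩
  have key : ∀ a ∈ Ioo (x - ε / 4) (x + ε), ∀ b ∈ Ioo (x - ε / 4) (x + ε), a < b →
      (f (x - ε / 4) - f (x - ε / 2)) / (x - ε / 4 - (x - ε / 2)) * |a - b| ≤ |f a - f b| := by
    intro a ha b hb hab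
    have ha' : a ∈ s := hball ⟨by linarith [ha.1], ha.2⟩
    have hb' : b ∈ s := hball ⟨by linarith [hb.1], hb.2⟩
    have h1 := hf.slope_mono_adjacent hp ha' (show x - ε / 2 < x - ε / 4 by linarith) ha.1
    have h2 := hf.slope_mono_adjacent hq hb' ha.1 hab
    have h3 := (h1.trans h2)
    rw [le_div_iff₀ (by linarith)] at h3
    rw [abs_sub_comm, abs_of_pos (sub_pos.2 hab), abs_sub_comm (f a),
      abs_of_pos (sub_pos.2 (hmono ha' hb' hab))]
    exact h3
  intro a ha b hb
  rcases lt_trichotomy a b with h | h | h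
  · exact key a ha b hb h
  · simp [h]
  · rw [abs_sub_comm a, abs_sub_comm (f a)]
    exact key b hb a ha h

lemma volume_preimage_eq_zero_of_strictAntiOn {f : ℝ → ℝ} {s N : Set ℝ} (hs : IsOpen s)
    (hf : ConvexOn ℝ s f) (hanti : StrictAntiOn f s) (hN : volume N = 0) :
    volume (s ∩ f ⁻¹' N) = 0 := by
  have hconv : ConvexOn ℝ (Neg.neg ⁻¹' s) (f ∘ Neg.neg) :=
    hf.comp_linearMap (-LinearMap.id : ℝ →ₗ[ℝ] ℝ)
  have h := volume_preimage_eq_zero_of_strictMonoOn (hs.preimage continuous_neg) hconv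
    (fun a ha b hb hab => hanti hb ha (neg_lt_neg hab)) hN
  have h2 : Neg.neg ⁻¹' s ∩ f ∘ Neg.neg ⁻¹' N = Neg.neg ⁻¹' (s ∩ f ⁻¹' N) := rfl
  rwa [h2, Measure.measure_preimage_neg] at h

lemma convexOn_inv_Ioi : ConvexOn ℝ (Ioi 0) fun x : ℝ => x⁻¹ := by
  simpa using convexOn_zpow (𝕜 := ℝ) (-1)

/-! ### Generators and their pseudo-inverses -/

namespace IsWilliamsonMeasure

variable {γ : Measure ℝ}

lemma ae_pos (hγ : IsWilliamsonMeasure γ) : ∀ᵐ t ∂γ, 0 < t := by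
  rw [ae_iff]
  simpa [Iic] using hγ.measure_Iic_zero

lemma ae_norm_le_one (hγ : IsWilliamsonMeasure γ) {z : ℝ} (hz : 0 ≤ z) :
    ∀ᵐ t ∂γ, ‖max (1 - t * z) 0‖ ≤ (1 : ℝ) := by
  filter_upwards [hγ.ae_pos] with t ht
  rw [Real.norm_of_nonneg (le_max_right _ _)]
  exact max_le (by nlinarith) zero_le_one

lemma integrable (hγ : IsWilliamsonMeasure γ) {z : ℝ} (hz : 0 ≤ z) :
    Integrable (fun t => max (1 - t * z) 0) γ := by
  have := hγ.isProbabilityMeasure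
  exact (integrable_const (1 : ℝ)).mono' (by fun_prop) (hγ.ae_norm_le_one hz)

lemma ofReal_generator (hγ : IsWilliamsonMeasure γ) {z : ℝ} (hz : 0 ≤ z) :
    ENNReal.ofReal (generator γ z) = ∫⁻ t, ENNReal.ofReal (1 - t * z) ∂γ := by
  rw [generator, ofReal_integral_eq_lintegral_ofReal (hγ.integrable hz)
    (ae_of_all _ fun _ => le_max_right _ _)]
  refine lintegral_congr fun t => ?_
  rw [ENNReal.ofReal_max, ENNReal.ofReal_zero, max_eq_left (zero_le)]

lemma continuousOn_generator (hγ : IsWilliamsonMeasure γ) :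
    ContinuousOn (generator γ) (Ici 0) := by
  have := hγ.isProbabilityMeasure
  exact continuousOn_of_dominated (bound := fun _ => 1) (fun z _ => by fun_prop)
    (fun z hz => hγ.ae_norm_le_one hz) (integrable_const _)
    (ae_of_all _ fun t => by fun_prop)

lemma convexOn_generator (hγ : IsWilliamsonMeasure γ) :
    ConvexOn ℝ (Ici 0) (generator γ) := by
  refine ⟨convex_Ici 0, fun x hx y hy a b ha hb hab => ?_⟩
  have hxy : 0 ≤ a • x + b • y := (convex_Ici (0 : ℝ)) hx hy ha hb hab
  simp only [generator, smul_eq_mul]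
  rw [← integral_const_mul, ← integral_const_mul, ← integral_add
    ((hγ.integrable hx).const_mul a) ((hγ.integrable hy).const_mul b)]
  refine integral_mono (hγ.integrable hxy)
    (((hγ.integrable hx).const_mul a).add ((hγ.integrable hy).const_mul b)) fun t => ?_
  refine max_le ?_ ?_
  · have h1 := mul_le_mul_of_nonneg_left (le_max_left (1 - t * x) 0) ha
    have h2 := mul_le_mul_of_nonneg_left (le_max_left (1 - t * y) 0) hb
    have h3 : 1 - t * (a * x + b * y) = a * (1 - t * x) + b * (1 - t * y) := by
      linear_combination (-1 : ℝ) * hab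
    simp only
    linarith
  · have h1 := mul_nonneg ha (le_max_right (1 - t * x) 0)
    have h2 := mul_nonneg hb (le_max_right (1 - t * y) 0)
    simp only
    linarith

lemma generator_zero (hγ : IsWilliamsonMeasure γ) : generator γ 0 = 1 := by
  have := hγ.isProbabilityMeasure
  simp [generator]

lemma generator_antitoneOn (hγ : IsWilliamsonMeasure γ) :
    AntitoneOn (generator γ) (Ici 0) := fun x hx y hy hxy => by
  refine integral_mono_ae (hγ.integrable hy) (hγ.integrable hx) ?_
  filter_upwards [hγ.ae_pos] with t ht
  exact max_le_max (by nlinarith) le_rfl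

lemma generator_le_one (hγ : IsWilliamsonMeasure γ) {z : ℝ} (hz : 0 ≤ z) :
    generator γ z ≤ 1 :=
  hγ.generator_zero ▸ hγ.generator_antitoneOn self_mem_Ici hz hz

end IsWilliamsonMeasure

lemma generator_nonneg (γ : Measure ℝ) (z : ℝ) : 0 ≤ generator γ z :=
  integral_nonneg fun _ => le_max_right _ _

namespace IsWilliamsonMeasure

variable {γ : Measure ℝ}

lemma generator_pos_iff (hγ : IsWilliamsonMeasure γ) {z : ℝ} (hz : 0 ≤ z) :
    0 < generator γ z ↔ γ {t | t * z < 1} ≠ 0 := by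
  rw [generator, integral_pos_iff_support_of_nonneg (f := fun t => max (1 - t * z) 0)
    (fun _ => le_max_right _ _)
    (hγ.integrable hz), pos_iff_ne_zero]
  have : (Function.support fun t : ℝ => max (1 - t * z) 0) = {t | t * z < 1} := by
    ext t
    simp [Function.mem_support]
  rw [this]

/-- Equal integrals of ordered integrands force equality almost everywhere. For `t > 0` this is
possible only if `t x ≥ 1`, and then `ψ(x) = 0`. -/
lemma generator_lt (hγ : IsWilliamsonMeasure γ) {x y : ℝ} (hx : 0 ≤ x) (hxy : x < y)
    (hpos : 0 < generator γ x) : generator γ y < generator γ x := by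
  have hy := hx.trans hxy.le
  refine (hγ.generator_antitoneOn hx hy hxy.le).lt_of_ne fun h => ?_
  rw [generator_pos_iff hγ hx] at hpos
  refine hpos ?_
  have hle : (fun t : ℝ => max (1 - t * y) 0) ≤ᵐ[γ] fun t => max (1 - t * x) 0 := by
    filter_upwards [hγ.ae_pos] with t ht
    exact max_le_max (by nlinarith) le_rfl
  have hae := (integral_eq_iff_of_ae_le (hγ.integrable hy) (hγ.integrable hx) hle).1 h
  have : ∀ᵐ t ∂γ, ¬ t * x < 1 := by
    filter_upwards [hγ.ae_pos, hae] with t ht h1 h2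
    have h3 : max (1 - t * y) 0 < max (1 - t * x) 0 := by
      rw [max_lt_iff, lt_max_iff, lt_max_iff]
      constructor <;> left <;> nlinarith
    exact h3.ne h1
  simpa [ae_iff] using this

lemma tendsto_generator (hγ : IsWilliamsonMeasure γ) :
    Filter.Tendsto (generator γ) Filter.atTop (nhds 0) := by
  have := hγ.isProbabilityMeasure
  rw [← integral_zero ℝ ℝ (μ := γ)]
  refine tendsto_integral_filter_of_dominated_convergence (fun _ => 1)
    (Filter.Eventually.of_forall fun z => by fun_prop) ?_ (integrable_const _) ?_
  · filter_upwards [Filter.eventually_ge_atTop 0] with z hz using hγ.ae_norm_le_one hz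
  · filter_upwards [hγ.ae_pos] with t ht
    refine tendsto_const_nhds.congr' ?_
    filter_upwards [Filter.eventually_ge_atTop t⁻¹] with z hz
    rw [max_eq_right]
    have := mul_le_mul_of_nonneg_left hz ht.le
    rw [mul_inv_cancel₀ ht.ne'] at this
    linarith

lemma exists_generator_eq (hγ : IsWilliamsonMeasure γ) {y : ℝ} (hy : y ∈ Ioo (0 : ℝ) 1) :
    ∃ z, 0 < z ∧ generator γ z = y := by
  obtain ⟨b, hb, hb0⟩ := ((hγ.tendsto_generator.eventually (gt_mem_nhds hy.1)).and
    (Filter.eventually_ge_atTop 0)).exists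
  obtain ⟨z, hz, hzy⟩ := intermediate_value_Icc' hb0
    (hγ.continuousOn_generator.mono Icc_subset_Ici_self)
    (show y ∈ Icc (generator γ b) (generator γ 0) from ⟨hb.le, hγ.generator_zero ▸ hy.2.le⟩)
  refine ⟨z, hz.1.lt_of_ne ?_, hzy⟩
  rintro rfl
  rw [hγ.generator_zero] at hzy
  exact hy.2.ne' hzy

lemma pseudoInverse_generator (hγ : IsWilliamsonMeasure γ) {z : ℝ} (hz : 0 ≤ z)
    (hpos : 0 < generator γ z) : pseudoInverse γ (generator γ z) = z := by
  have : {w : ℝ | 0 ≤ w ∧ generator γ w = generator γ z} = {z} := by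
    ext w
    refine ⟨fun h => ?_, fun h => by rw [mem_singleton_iff.1 h]; exact ⟨hz, rfl⟩⟩
    rcases lt_trichotomy w z with h1 | h1 | h1
    · exact absurd h.2 (hγ.generator_lt h.1 h1 (h.2 ▸ hpos)).ne'
    · exact h1
    · exact absurd h.2 (hγ.generator_lt hz h1 hpos).ne
  rw [pseudoInverse, this, csInf_singleton]

lemma pseudoInverse_pos (hγ : IsWilliamsonMeasure γ) {y : ℝ} (hy : y ∈ Ioo (0 : ℝ) 1) :
    0 < pseudoInverse γ y := by
  obtain ⟨z, hz, rfl⟩ := hγ.exists_generator_eq hy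
  rwa [hγ.pseudoInverse_generator hz.le hy.1]

lemma generator_pseudoInverse (hγ : IsWilliamsonMeasure γ) {y : ℝ} (hy : y ∈ Ioo (0 : ℝ) 1) :
    generator γ (pseudoInverse γ y) = y := by
  obtain ⟨z, hz, rfl⟩ := hγ.exists_generator_eq hy
  rw [hγ.pseudoInverse_generator hz.le hy.1]

/-- Valid also where `ψ` vanishes. It turns events `ψ(W) ≤ y` into events `φ(y) ≤ W`. -/
lemma generator_le_iff (hγ : IsWilliamsonMeasure γ) {y z : ℝ} (hy : y ∈ Ioo (0 : ℝ) 1)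
    (hz : 0 ≤ z) : generator γ z ≤ y ↔ pseudoInverse γ y ≤ z := by
  have h0 := hγ.pseudoInverse_pos hy
  refine ⟨fun h => ?_, fun h => ?_⟩
  · by_contra! hlt
    have hpos : 0 < generator γ z := by
      refine (hy.1.trans_eq (hγ.generator_pseudoInverse hy).symm).trans_le
        (hγ.generator_antitoneOn hz h0.le hlt.le)
    have := hγ.generator_lt hz hlt hpos
    rw [hγ.generator_pseudoInverse hy] at this
    exact this.not_ge h
  · exact (hγ.generator_antitoneOn h0.le hz h).trans_eq (hγ.generator_pseudoInverse hy)

lemma generator_mem_Ioo (hγ : IsWilliamsonMeasure γ) {z : ℝ} (hz : 0 < z)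
    (hpos : 0 < generator γ z) : generator γ z ∈ Ioo (0 : ℝ) 1 :=
  ⟨hpos, by
    have := hγ.generator_lt le_rfl hz (hγ.generator_zero ▸ one_pos)
    rwa [hγ.generator_zero] at this⟩

end IsWilliamsonMeasure

/-! ### The stable tail dependence function -/

/-- The stable tail dependence function `ℓ(z,w) = 2 ∫ max (z(1 - s)) (w s) dϑ(s)`. -/
def tailFunction (ϑ : Measure I) (z w : ℝ) : ℝ :=
  ∫ s : I, 2 * max (z * (1 - (s : ℝ))) (w * s) ∂ϑ

/-- The positive part `(t - s)₊` is the integral of the indicator of `[s, ∞)` over `[0, t]`. -/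
lemma lintegral_indicator_le {s t : ℝ} (hs : 0 ≤ s) :
    ∫⁻ z in Ioc 0 t, (Ici s).indicator 1 z = ENNReal.ofReal (t - s) := by
  rw [lintegral_indicator_one measurableSet_Ici, Measure.restrict_apply measurableSet_Ici]
  refine le_antisymm ?_ ?_
  · refine (measure_mono (t := Icc s t) fun z hz => ⟨hz.1, hz.2.2⟩).trans_eq Real.volume_Icc
  · rw [← Real.volume_Ioc]
    exact measure_mono fun z hz => ⟨hz.1.le, hs.trans_lt hz.1, hz.2⟩

namespace IsPickandsMeasure

variable {ϑ : Measure I}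

lemma integrable_of_continuous (hϑ : IsPickandsMeasure ϑ) {f : I → ℝ} (hf : Continuous f) :
    Integrable f ϑ := by
  have := hϑ.isProbabilityMeasure
  exact hf.integrable_of_hasCompactSupport (HasCompactSupport.of_compactSpace f)

lemma integral_cdf (hϑ : IsPickandsMeasure ϑ) {t : ℝ} (ht : 0 ≤ t) :
    ∫ z in (0 : ℝ)..t, ϑ.real {s : I | (s : ℝ) ≤ z} = ∫ s : I, max (t - s) 0 ∂ϑ := by
  have := hϑ.isProbabilityMeasure
  have hmono : Monotone fun z : ℝ => ϑ {s : I | (s : ℝ) ≤ z} := fun a b hab =>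
    measure_mono fun s (hs : (s : ℝ) ≤ a) => hs.trans hab
  have hind : ∀ z : ℝ, ϑ {s : I | (s : ℝ) ≤ z} =
      ∫⁻ s : I, (Ici (s : ℝ)).indicator 1 z ∂ϑ := fun z => by
    have hm : MeasurableSet {s : I | (s : ℝ) ≤ z} :=
      measurableSet_le measurable_subtype_coe measurable_const
    rw [← lintegral_indicator_one hm]
    rfl
  have hmeas : Measurable fun p : ℝ × I => (Ici (p.2 : ℝ)).indicator (1 : ℝ → ℝ≥0∞) p.1 := by
    have : MeasurableSet {p : ℝ × I | (p.2 : ℝ) ≤ p.1} :=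
      measurableSet_le (by fun_prop) (by fun_prop)
    exact measurable_one.indicator this
  rw [intervalIntegral.integral_of_le ht]
  simp only [Measure.real]
  rw [integral_toReal hmono.measurable.aemeasurable (ae_of_all _ fun _ => measure_lt_top _ _),
    integral_eq_lintegral_of_nonneg_ae (f := fun s : I => max (t - s) 0)
      (ae_of_all _ fun _ => le_max_right _ _) (by fun_prop)]
  congr 1
  simp only [hind]
  rw [lintegral_lintegral_swap hmeas.aemeasurable]
  refine lintegral_congr fun s => ?_
  rw [lintegral_indicator_le s.2.1, ENNReal.ofReal_max, ENNReal.ofReal_zero, max_eq_left zero_le]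

/-- The mean `1/2` allows `1 - t` to be written as `∫ 2(1-t)s dϑ(s)`; pointwise, `(t-s)₊ + (1-t)s`
is the maximum of `t(1-s)` and `(1-t)s`. -/
lemma pickandsFunction_eq (hϑ : IsPickandsMeasure ϑ) {t : ℝ} (ht : 0 ≤ t) :
    pickandsFunction ϑ t = tailFunction ϑ t (1 - t) := by
  have := hϑ.isProbabilityMeasure
  have h1 : ∀ s : I, 2 * max (t * (1 - (s : ℝ))) ((1 - t) * s) =
      2 * (1 - t) * s + 2 * max (t - s) 0 := fun s => by
    have : max (t * (1 - (s : ℝ))) ((1 - t) * s) = max (t - s) 0 + (1 - t) * s := by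
      rw [← max_add_add_right]; congr 1 <;> ring
    rw [this]; ring
  rw [pickandsFunction, hϑ.integral_cdf ht, tailFunction]
  simp only [h1]
  rw [integral_add (hϑ.integrable_of_continuous (by fun_prop))
    (hϑ.integrable_of_continuous (by fun_prop)), integral_const_mul, integral_const_mul,
    hϑ.integral_eq]
  ring

lemma mul_pickandsFunction (hϑ : IsPickandsMeasure ϑ) {z w : ℝ} (hz : 0 < z) (hw : 0 < w) :
    (z + w) * pickandsFunction ϑ (z / (z + w)) = tailFunction ϑ z w := by
  have hzw : 0 < z + w := by linarith
  rw [hϑ.pickandsFunction_eq (by positivity), tailFunction, tailFunction, ← integral_const_mul]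
  refine integral_congr_ae (ae_of_all _ fun s => ?_)
  simp only
  have h1 : 1 - z / (z + w) = w / (z + w) := by field_simp; ring
  rw [h1, mul_left_comm, mul_max_of_nonneg _ _ hzw.le]
  congr 2 <;> field_simp

lemma continuous_tailFunction (hϑ : IsPickandsMeasure ϑ) :
    Continuous fun p : ℝ × ℝ => tailFunction ϑ p.1 p.2 := by
  have := hϑ.isProbabilityMeasure
  have h := continuous_parametric_integral_of_continuous (μ := ϑ)
    (f := fun (p : ℝ × ℝ) (s : I) => 2 * max (p.1 * (1 - (s : ℝ))) (p.2 * s))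
    (by fun_prop) isCompact_univ
  simpa only [Measure.restrict_univ, tailFunction] using h

/-- This and its mirror image express the mean condition; they yield the uniform margins and the
bound of `ℓ` below by each argument. -/
lemma tailFunction_zero_right (hϑ : IsPickandsMeasure ϑ) {z : ℝ} (hz : 0 ≤ z) :
    tailFunction ϑ z 0 = z := by
  have := hϑ.isProbabilityMeasure
  have h1 : ∀ s : I, 2 * max (z * (1 - (s : ℝ))) (0 * s) = 2 * z - 2 * z * s := fun s => by
    rw [zero_mul, max_eq_left (mul_nonneg hz (by linarith [s.2.2]))]; ring
  rw [tailFunction]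
  simp only [h1]
  rw [integral_sub (integrable_const _) (hϑ.integrable_of_continuous (by fun_prop)),
    integral_const_mul (2 * z), hϑ.integral_eq, integral_const, probReal_univ, one_smul]
  ring

lemma tailFunction_zero_left (hϑ : IsPickandsMeasure ϑ) {w : ℝ} (hw : 0 ≤ w) :
    tailFunction ϑ 0 w = w := by
  have h1 : ∀ s : I, 2 * max (0 * (1 - (s : ℝ))) (w * s) = 2 * w * s := fun s => by
    rw [zero_mul, max_eq_right (mul_nonneg hw s.2.1)]; ring
  rw [tailFunction]
  simp only [h1]
  rw [integral_const_mul, hϑ.integral_eq]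
  ring

lemma tailFunction_mono (hϑ : IsPickandsMeasure ϑ) {z z' w w' : ℝ} (hz : z ≤ z')
    (hw : w ≤ w') : tailFunction ϑ z w ≤ tailFunction ϑ z' w' := by
  refine integral_mono (hϑ.integrable_of_continuous (by fun_prop))
    (hϑ.integrable_of_continuous (by fun_prop)) fun s => ?_
  have h1 := mul_le_mul_of_nonneg_right hz (show 0 ≤ 1 - (s : ℝ) by linarith [s.2.2])
  have h2 := mul_le_mul_of_nonneg_right hw s.2.1
  exact mul_le_mul_of_nonneg_left (max_le_max h1 h2) zero_le_two

lemma left_le_tailFunction (hϑ : IsPickandsMeasure ϑ) {z w : ℝ} (hz : 0 ≤ z) (hw : 0 ≤ w) :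
    z ≤ tailFunction ϑ z w :=
  (hϑ.tailFunction_zero_right hz).symm.trans_le (hϑ.tailFunction_mono le_rfl hw)

lemma right_le_tailFunction (hϑ : IsPickandsMeasure ϑ) {z w : ℝ} (hz : 0 ≤ z) (hw : 0 ≤ w) :
    w ≤ tailFunction ϑ z w :=
  (hϑ.tailFunction_zero_left hw).symm.trans_le (hϑ.tailFunction_mono hz le_rfl)

lemma convexOn_tailFunction (hϑ : IsPickandsMeasure ϑ) (z : ℝ) :
    ConvexOn ℝ univ (tailFunction ϑ z) := by
  refine ⟨convex_univ, fun x _ y _ a b ha hb hab => ?_⟩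
  simp only [tailFunction, smul_eq_mul]
  rw [← integral_const_mul, ← integral_const_mul, ← integral_add
    (hϑ.integrable_of_continuous (by fun_prop)) (hϑ.integrable_of_continuous (by fun_prop))]
  refine integral_mono (hϑ.integrable_of_continuous (by fun_prop))
    (hϑ.integrable_of_continuous (by fun_prop)) fun s => ?_
  have h1 := mul_le_mul_of_nonneg_left (le_max_left (z * (1 - (s : ℝ))) (x * s)) ha
  have h2 := mul_le_mul_of_nonneg_left (le_max_left (z * (1 - (s : ℝ))) (y * s)) hb
  have h3 := mul_le_mul_of_nonneg_left (le_max_right (z * (1 - (s : ℝ))) (x * s)) ha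
  have h4 := mul_le_mul_of_nonneg_left (le_max_right (z * (1 - (s : ℝ))) (y * s)) hb
  have h5 : max (z * (1 - (s : ℝ))) ((a * x + b * y) * s) ≤
      a * max (z * (1 - (s : ℝ))) (x * s) + b * max (z * (1 - (s : ℝ))) (y * s) := by
    refine max_le ?_ (by linarith)
    have : z * (1 - (s : ℝ)) = a * (z * (1 - (s : ℝ))) + b * (z * (1 - (s : ℝ))) := by
      rw [← add_mul, hab, one_mul]
    linarith
  simp only
  linarith

/-- The stable tail dependence function is strictly increasing in the second variable where it
exceeds its value in `0`. -/
lemma tailFunction_strictMonoOn (hϑ : IsPickandsMeasure ϑ) {z : ℝ} (hz : 0 ≤ z) :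
    StrictMonoOn (tailFunction ϑ z) {w | 0 < w ∧ z < tailFunction ϑ z w} := by
  intro a ha b _ hab
  have h := (hϑ.convexOn_tailFunction z).slope_mono_adjacent (mem_univ 0) (mem_univ b) ha.1 hab
  rw [hϑ.tailFunction_zero_right hz] at h
  have h1 : 0 < (tailFunction ϑ z a - z) / (a - 0) := by
    rw [sub_zero]; exact div_pos (sub_pos.2 ha.2) ha.1
  have h2 := h1.trans_le h
  rw [div_pos_iff_of_pos_right (sub_pos.2 hab)] at h2
  linarith

lemma isOpen_lt_tailFunction (hϑ : IsPickandsMeasure ϑ) (z : ℝ) :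
    IsOpen {w | 0 < w ∧ z < tailFunction ϑ z w} :=
  (isOpen_lt continuous_const continuous_id).inter
    (isOpen_lt continuous_const (hϑ.continuous_tailFunction.comp (by fun_prop :
      Continuous fun w : ℝ => (z, w))))

lemma convexOn_tailFunction_lt (hϑ : IsPickandsMeasure ϑ) (z : ℝ) :
    ConvexOn ℝ {w | 0 < w ∧ z < tailFunction ϑ z w} (tailFunction ϑ z) := by
  refine (hϑ.convexOn_tailFunction z).subset (subset_univ _) (OrdConnected.convex ⟨?_⟩)
  exact fun a ha b _ w hw => ⟨ha.1.trans_le hw.1,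
    ha.2.trans_le (hϑ.tailFunction_mono le_rfl hw.1)⟩

end IsPickandsMeasure

/-! ### The conditional law on the scale of the generator -/

/-- The largest `w` with `t ℓ(z,w) ≤ 1` and `s w ≤ z (1 - s)`. -/
def levelPoint (ϑ : Measure I) (z t : ℝ) (s : I) : ℝ :=
  if 0 < z ∧ 0 < t ∧ t * z < 1 then
    sSup {w : ℝ | 0 ≤ w ∧ t * tailFunction ϑ z w ≤ 1 ∧ s * w ≤ z * (1 - s)}
  else 0

lemma levelPoint_nonneg (ϑ : Measure I) (z t : ℝ) (s : I) : 0 ≤ levelPoint ϑ z t s := by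
  rw [levelPoint]
  split_ifs
  exacts [Real.sSup_nonneg fun _ h => h.1, le_rfl]

/-- The law with density `t 1{t z < 1}` with respect to `γ` and `2 (1 - s)` with respect to
`ϑ`, not normalized. -/
def conditionalMeasure (γ : Measure ℝ) (ϑ : Measure I) (z : ℝ) : Measure (ℝ × I) :=
  (γ.prod ϑ).withDensity fun p =>
    if p.1 * z < 1 then ENNReal.ofReal (p.1 * (2 * (1 - (p.2 : ℝ)))) else 0

/-- The right derivative of `-ψ`, that is `∫ t 1{t z < 1} dγ(t)`. -/
def generatorRate (γ : Measure ℝ) (z : ℝ) : ℝ≥0∞ :=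
  ∫⁻ t, (if t * z < 1 then ENNReal.ofReal t else 0) ∂γ

namespace IsPickandsMeasure

variable {ϑ : Measure I}

/-- Both constraints are closed and monotone in `w`, hold at `w = 0`, and force `w ≤ 1/t` because `w
≤ ℓ(z,w)`. The admissible levels thus form a compact interval starting at `0`. -/
lemma le_levelPoint_iff (hϑ : IsPickandsMeasure ϑ) {z t w : ℝ} {s : I} (hz : 0 < z)
    (ht : 0 < t) (htz : t * z < 1) (hw : 0 ≤ w) :
    w ≤ levelPoint ϑ z t s ↔ t * tailFunction ϑ z w ≤ 1 ∧ s * w ≤ z * (1 - s) := by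
  rw [levelPoint, if_pos ⟨hz, ht, htz⟩]
  set S := {w : ℝ | 0 ≤ w ∧ t * tailFunction ϑ z w ≤ 1 ∧ s * w ≤ z * (1 - s)} with hS
  have hcont : Continuous fun w : ℝ => tailFunction ϑ z w :=
    hϑ.continuous_tailFunction.comp (by fun_prop : Continuous fun w : ℝ => (z, w))
  have hclosed : IsClosed S :=
    (isClosed_le continuous_const continuous_id).inter
      ((isClosed_le (hcont.const_mul t) continuous_const).inter
        (isClosed_le (continuous_const_mul (s : ℝ)) continuous_const))
  have hne : (0 : ℝ) ∈ S := by
    refine ⟨le_rfl, ?_, ?_⟩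
    · rw [hϑ.tailFunction_zero_right hz.le]; exact htz.le
    · rw [mul_zero]; exact mul_nonneg hz.le (by linarith [s.2.2])
  have hbdd : BddAbove S := ⟨t⁻¹, fun v hv => by
    have h1 := hϑ.right_le_tailFunction hz.le hv.1
    rw [← mul_le_mul_iff_right₀ ht, mul_inv_cancel₀ ht.ne']
    exact (mul_le_mul_of_nonneg_left h1 ht.le).trans hv.2.1⟩
  have hmem : sSup S ∈ S := hclosed.csSup_mem ⟨0, hne⟩ hbdd
  refine ⟨fun h => ⟨?_, ?_⟩, fun h => le_csSup hbdd ⟨hw, h⟩⟩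
  · exact (mul_le_mul_of_nonneg_left (hϑ.tailFunction_mono le_rfl h) ht.le).trans hmem.2.1
  · exact (mul_le_mul_of_nonneg_left h s.2.1).trans hmem.2.2

/-- At the level point one of the two constraints is active. -/
lemma levelPoint_spec (hϑ : IsPickandsMeasure ϑ) {z t : ℝ} {s : I} (hz : 0 < z)
    (ht : 0 < t) (htz : t * z < 1) :
    t * tailFunction ϑ z (levelPoint ϑ z t s) = 1 ∨ s * levelPoint ϑ z t s = z * (1 - s) := by
  set v := levelPoint ϑ z t s with hv
  have hv0 : 0 ≤ v := levelPoint_nonneg ϑ z t s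
  have h1 := (hϑ.le_levelPoint_iff (s := s) hz ht htz hv0).1 le_rfl
  by_contra! hne
  have hcont : Continuous fun w : ℝ => tailFunction ϑ z w :=
    hϑ.continuous_tailFunction.comp (by fun_prop : Continuous fun w : ℝ => (z, w))
  have hopen : IsOpen {w : ℝ | t * tailFunction ϑ z w < 1 ∧ s * w < z * (1 - s)} :=
    (isOpen_lt (hcont.const_mul t) continuous_const).inter
      (isOpen_lt (continuous_const_mul (s : ℝ)) continuous_const)
  have hmem : v ∈ {w : ℝ | t * tailFunction ϑ z w < 1 ∧ s * w < z * (1 - s)} :=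
    ⟨h1.1.lt_of_ne hne.1, h1.2.lt_of_ne hne.2⟩
  obtain ⟨ε, hε, hball⟩ := Metric.isOpen_iff.1 hopen v hmem
  have h2 : v + ε / 2 ∈ Metric.ball v ε := by
    rw [Real.ball_eq_Ioo]; constructor <;> linarith
  have h3 := hball h2
  have h4 := (hϑ.le_levelPoint_iff (s := s) hz ht htz (by linarith : 0 ≤ v + ε / 2)).2
    ⟨h3.1.le, h3.2.le⟩
  linarith

/-- At `w = 0` both constraints are strict, so neither can be the active one. -/
lemma levelPoint_pos (hϑ : IsPickandsMeasure ϑ) {z t : ℝ} {s : I} (hz : 0 < z)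
    (ht : 0 < t) (htz : t * z < 1) (hs : (s : ℝ) < 1) : 0 < levelPoint ϑ z t s := by
  refine (levelPoint_nonneg ϑ z t s).lt_of_ne' fun h => ?_
  rcases hϑ.levelPoint_spec (s := s) hz ht htz with h1 | h1
  · rw [h, hϑ.tailFunction_zero_right hz.le] at h1
    exact htz.ne h1
  · rw [h, mul_zero] at h1
    exact (mul_pos hz (sub_pos.2 hs)).ne h1

lemma measurable_levelPoint (hϑ : IsPickandsMeasure ϑ) :
    Measurable fun q : ℝ × (ℝ × I) => levelPoint ϑ q.1 q.2.1 q.2.2 := by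
  refine measurable_of_Ici fun w => ?_
  rcases le_or_gt w 0 with hw | hw
  · convert MeasurableSet.univ using 1
    exact eq_univ_of_forall fun q => hw.trans (levelPoint_nonneg ϑ _ _ _)
  have hcont : Continuous fun q : ℝ × (ℝ × I) => tailFunction ϑ q.1 w :=
    hϑ.continuous_tailFunction.comp
      (by fun_prop : Continuous fun q : ℝ × (ℝ × I) => (q.1, w))
  -- For `w > 0` the default value `0` never reaches `w`, so the superlevel set lies in the domain
  -- of the supremum.
  have : (fun q : ℝ × (ℝ × I) => levelPoint ϑ q.1 q.2.1 q.2.2) ⁻¹' Ici w =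
      {q | 0 < q.1} ∩ ({q | 0 < q.2.1} ∩ ({q | q.2.1 * q.1 < 1} ∩
        ({q | q.2.1 * tailFunction ϑ q.1 w ≤ 1} ∩
          {q | (q.2.2 : ℝ) * w ≤ q.1 * (1 - q.2.2)}))) := by
    ext ⟨z, t, s⟩
    simp only [mem_preimage, mem_Ici, mem_inter_iff, mem_ofPred_eq]
    refine ⟨fun h => ?_, fun h => (hϑ.le_levelPoint_iff h.1 h.2.1 h.2.2.1 hw.le).2 h.2.2.2⟩
    by_cases hd : 0 < z ∧ 0 < t ∧ t * z < 1
    · exact ⟨hd.1, hd.2.1, hd.2.2, (hϑ.le_levelPoint_iff hd.1 hd.2.1 hd.2.2 hw.le).1 h⟩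
    · rw [levelPoint, if_neg hd] at h
      exact absurd h hw.not_ge
  rw [this]
  refine (isOpen_lt continuous_const (by fun_prop)).measurableSet.inter
    ((isOpen_lt continuous_const (by fun_prop)).measurableSet.inter
      ((isOpen_lt (by fun_prop) continuous_const).measurableSet.inter
        ((isClosed_le (by fun_prop) continuous_const).measurableSet.inter
          (isClosed_le (by fun_prop) (by fun_prop)).measurableSet)))

lemma lintegral_two_mul (hϑ : IsPickandsMeasure ϑ) :
    ∫⁻ s : I, ENNReal.ofReal (2 * (1 - (s : ℝ))) ∂ϑ = 1 := by
  have := hϑ.isProbabilityMeasure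
  rw [← ofReal_integral_eq_lintegral_ofReal (hϑ.integrable_of_continuous (by fun_prop))
    (ae_of_all _ fun s => mul_nonneg zero_le_two (by linarith [s.2.2])), integral_const_mul,
    integral_sub (integrable_const _) (hϑ.integrable_of_continuous (by fun_prop)), hϑ.integral_eq,
    integral_const, probReal_univ]
  norm_num

lemma lintegral_slice_right {z₁ z₂ w : ℝ} (h12 : z₁ ≤ z₂) (s : I) :
    ∫⁻ z in Ioc z₁ z₂, (if (s : ℝ) * w ≤ z * (1 - s) then ENNReal.ofReal (2 * (1 - (s : ℝ)))
      else 0) = ENNReal.ofReal (2 * max (z₂ * (1 - (s : ℝ))) (w * s) -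
        2 * max (z₁ * (1 - (s : ℝ))) (w * s)) := by
  -- For `s < 1` the integrand is the derivative of `2 max (z(1-s)) (ws)` off its kink `c =
  -- sw/(1-s)`; for `s = 1` both sides vanish.
  rcases s.2.2.lt_or_eq with hs | hs
  · have hs' : 0 < 1 - (s : ℝ) := sub_pos.2 hs
    have hiff : ∀ z : ℝ, (s : ℝ) * w ≤ z * (1 - s) ↔ s * w / (1 - s) ≤ z := fun z =>
      (div_le_iff₀ hs').symm
    set c : ℝ := s * w / (1 - s) with hc
    have hcs : c * (1 - s) = w * s := by rw [hc]; field_simp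
    have hvol : volume (Ioc z₁ z₂ ∩ Ici c) = ENNReal.ofReal (z₂ - max z₁ c) := by
      refine le_antisymm ?_ ?_
      · rw [← Real.volume_Icc]
        exact measure_mono fun z hz => ⟨max_le hz.1.1.le hz.2, hz.1.2⟩
      · rw [← Real.volume_Ioc]
        exact measure_mono fun z hz =>
          ⟨⟨(le_max_left _ _).trans_lt hz.1, hz.2⟩, (le_max_right _ _).trans hz.1.le⟩
    have hind : ∀ z : ℝ, (if (s : ℝ) * w ≤ z * (1 - s) then ENNReal.ofReal (2 * (1 - (s : ℝ)))
        else 0) = (Ici c).indicator (fun _ => ENNReal.ofReal (2 * (1 - (s : ℝ)))) z := fun z => by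
      simp only [hiff, indicator, mem_Ici]
    simp only [hind]
    rw [lintegral_indicator_const measurableSet_Ici, Measure.restrict_apply measurableSet_Ici,
      inter_comm, hvol, ← ENNReal.ofReal_mul (by linarith), ← hcs,
      ← max_mul_of_nonneg _ _ hs'.le, ← max_mul_of_nonneg _ _ hs'.le]
    rcases le_total c z₂ with h | h
    · rw [max_eq_left h]; congr 1; ring
    · rw [max_eq_right h, max_eq_right (h12.trans h), sub_self, ENNReal.ofReal_zero]
      exact ENNReal.ofReal_eq_zero.2 (mul_nonpos_of_nonneg_of_nonpos (by linarith) (by linarith))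
  · simp [hs]

lemma measurable_slice (w : ℝ) : Measurable fun q : ℝ × I =>
    if (q.2 : ℝ) * w ≤ q.1 * (1 - q.2) then ENNReal.ofReal (2 * (1 - (q.2 : ℝ))) else 0 :=
  Measurable.ite (measurableSet_le (by fun_prop) (by fun_prop)) (by fun_prop) measurable_const

lemma lintegral_slice (hϑ : IsPickandsMeasure ϑ) {z₁ z₂ w : ℝ} (h12 : z₁ ≤ z₂) :
    ∫⁻ z in Ioc z₁ z₂, ∫⁻ s : I, (if (s : ℝ) * w ≤ z * (1 - s) then
      ENNReal.ofReal (2 * (1 - (s : ℝ))) else 0) ∂ϑ =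
      ENNReal.ofReal (tailFunction ϑ z₂ w - tailFunction ϑ z₁ w) := by
  have := hϑ.isProbabilityMeasure
  rw [lintegral_lintegral_swap (measurable_slice w).aemeasurable]
  simp only [lintegral_slice_right h12]
  rw [tailFunction, tailFunction, ← integral_sub (hϑ.integrable_of_continuous (by fun_prop))
    (hϑ.integrable_of_continuous (by fun_prop)), ofReal_integral_eq_lintegral_ofReal
    (f := fun s : I => 2 * max (z₂ * (1 - (s : ℝ))) (w * s) -
        2 * max (z₁ * (1 - (s : ℝ))) (w * s))
    ((hϑ.integrable_of_continuous (by fun_prop)).sub (hϑ.integrable_of_continuous (by fun_prop)))]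
  refine ae_of_all _ fun s => ?_
  have := mul_le_mul_of_nonneg_right h12 (show 0 ≤ 1 - (s : ℝ) by linarith [s.2.2])
  exact sub_nonneg.2 (mul_le_mul_of_nonneg_left (max_le_max this le_rfl) zero_le_two)

/-- For fixed `w` the function `t ℓ(·,w)` reaches the level `1` at a last point. -/
lemma exists_last_level (hϑ : IsPickandsMeasure ϑ) {z₁ t w : ℝ} (hz₁ : 0 ≤ z₁) (ht : 0 < t)
    (hw : 0 ≤ w) (h1 : t * tailFunction ϑ z₁ w ≤ 1) :
    ∃ z₂, z₁ ≤ z₂ ∧ t * tailFunction ϑ z₂ w = 1 ∧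
      ∀ z, 0 ≤ z → (t * tailFunction ϑ z w ≤ 1 ↔ z ≤ z₂) := by
  have hcont : Continuous fun z : ℝ => t * tailFunction ϑ z w :=
    continuous_const.mul (hϑ.continuous_tailFunction.comp
      (by fun_prop : Continuous fun z : ℝ => (z, w)))
  have hle : ∀ z, 0 ≤ z → t * tailFunction ϑ z w ≤ 1 → z ≤ t⁻¹ := fun z hz h => by
    have h2 := mul_le_mul_of_nonneg_left (hϑ.left_le_tailFunction hz hw) ht.le
    rw [← mul_le_mul_iff_right₀ ht, mul_inv_cancel₀ ht.ne']
    exact h2.trans h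
  set S := {z : ℝ | z₁ ≤ z ∧ t * tailFunction ϑ z w ≤ 1} with hS
  have hbdd : BddAbove S := ⟨t⁻¹, fun z hz => hle z (hz₁.trans hz.1) hz.2⟩
  have hclosed : IsClosed S := (isClosed_le continuous_const continuous_id).inter
    (isClosed_le hcont continuous_const)
  have hmem : sSup S ∈ S := hclosed.csSup_mem ⟨z₁, le_rfl, h1⟩ hbdd
  refine ⟨sSup S, hmem.1, hmem.2.antisymm ?_, fun z hz => ⟨fun h => ?_, fun h => ?_⟩⟩
  · by_contra! hlt
    have hopen := isOpen_lt hcont continuous_const |>.mem_nhds hlt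
    obtain ⟨ε, hε, hball⟩ := Metric.mem_nhds_iff.1 hopen
    have h2 : sSup S + ε / 2 ∈ Metric.ball (sSup S) ε := by
      rw [Real.ball_eq_Ioo]; constructor <;> linarith
    have h3 : sSup S + ε / 2 ≤ sSup S :=
      le_csSup hbdd ⟨by linarith [hmem.1], (hball h2).le⟩
    linarith
  · rcases le_total z₁ z with h' | h'
    · exact le_csSup hbdd ⟨h', h⟩
    · exact h'.trans hmem.1
  · exact (mul_le_mul_of_nonneg_left (hϑ.tailFunction_mono h le_rfl) ht.le).trans hmem.2

/-- For fixed `t`, the constraint `t ℓ(z,w) ≤ 1` cuts the range of `z` at a last point `z₂`. On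
`(z₁, z₂]` the inner integral is `t` times the density of `ℓ(·,w)`, so the total is `t ℓ(z₂,w) - t
ℓ(z₁,w)`, and `t ℓ(z₂,w) = 1`. -/
lemma lintegral_levelPoint (hϑ : IsPickandsMeasure ϑ) {z₁ t w : ℝ} (hz₁ : 0 ≤ z₁)
    (ht : 0 < t) (hw : 0 ≤ w) :
    ∫⁻ z in Ioi z₁, ∫⁻ s : I, (if t * z < 1 ∧ w ≤ levelPoint ϑ z t s then
      ENNReal.ofReal (t * (2 * (1 - (s : ℝ)))) else 0) ∂ϑ =
      ENNReal.ofReal (1 - t * tailFunction ϑ z₁ w) := by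
  by_cases h1 : t * tailFunction ϑ z₁ w ≤ 1
  · obtain ⟨z₂, h12, hz₂, hlevel⟩ := hϑ.exists_last_level hz₁ ht hw h1
    have hae : ∀ᵐ z ∂volume.restrict (Ioi z₁), ∫⁻ s : I, (if t * z < 1 ∧
        w ≤ levelPoint ϑ z t s then ENNReal.ofReal (t * (2 * (1 - (s : ℝ)))) else 0) ∂ϑ =
        (Ioc z₁ z₂).indicator (fun z => ENNReal.ofReal t * ∫⁻ s : I, (if (s : ℝ) * w ≤ z * (1 - s)
          then ENNReal.ofReal (2 * (1 - (s : ℝ))) else 0) ∂ϑ) z := by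
      filter_upwards [ae_restrict_mem measurableSet_Ioi,
        ae_restrict_of_ae (Measure.ae_ne volume t⁻¹)] with z hz hne
      have hz0 : 0 < z := hz₁.trans_lt hz
      by_cases hz2 : z ≤ z₂
      · have hl := (hlevel z hz0.le).2 hz2
        -- Since `z ≤ ℓ(z,w)`, strictness can fail only at the discarded point `z = 1/t`.
        have htz : t * z < 1 := by
          refine lt_of_le_of_ne ((mul_le_mul_of_nonneg_left
            (hϑ.left_le_tailFunction hz0.le hw) ht.le).trans hl) fun h => hne ?_
          exact eq_inv_of_mul_eq_one_right h
        rw [indicator_of_mem (show z ∈ Ioc z₁ z₂ from ⟨hz, hz2⟩),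
          ← lintegral_const_mul' _ _ ENNReal.ofReal_ne_top]
        refine lintegral_congr fun s => ?_
        simp only [hϑ.le_levelPoint_iff hz0 ht htz hw, ENNReal.ofReal_mul ht.le, htz, hl,
          true_and, mul_ite, mul_zero]
      · rw [indicator_of_notMem fun h => hz2 h.2]
        refine (lintegral_congr fun s => if_neg ?_).trans lintegral_zero
        rintro ⟨htz, h⟩
        exact hz2 ((hlevel z hz0.le).1 ((hϑ.le_levelPoint_iff hz0 ht htz hw).1 h).1)
    rw [lintegral_congr_ae hae, lintegral_indicator measurableSet_Ioc,
      Measure.restrict_restrict measurableSet_Ioc, inter_eq_left.2 Ioc_subset_Ioi_self,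
      lintegral_const_mul', hϑ.lintegral_slice h12, ← ENNReal.ofReal_mul ht.le, mul_sub, hz₂]
    exact ENNReal.ofReal_ne_top
  · rw [ENNReal.ofReal_eq_zero.2 (by linarith)]
    refine (setLIntegral_congr_fun measurableSet_Ioi fun z hz => ?_).trans lintegral_zero
    refine (lintegral_congr fun s => if_neg ?_).trans lintegral_zero
    rintro ⟨htz, h⟩
    refine h1 (le_trans ?_ ((hϑ.le_levelPoint_iff (hz₁.trans_lt hz) ht htz hw).1 h).1)
    exact mul_le_mul_of_nonneg_left (hϑ.tailFunction_mono (le_of_lt hz) le_rfl) ht.le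

end IsPickandsMeasure

/-! ### The generator as a change of variables between the half-line and the unit interval -/

lemma measurable_generator (γ : Measure ℝ) [IsProbabilityMeasure γ] :
    Measurable (generator γ) :=
  (StronglyMeasurable.integral_prod_right (f := fun (z t : ℝ) => max (1 - t * z) 0)
    (by fun_prop : Measurable fun p : ℝ × ℝ => max (1 - p.2 * p.1) 0).stronglyMeasurable).measurable

/-- The generator with values in the unit interval. -/
def unitGenerator (γ : Measure ℝ) (z : ℝ) : I :=
  projIcc 0 1 zero_le_one (generator γ z)

/-- The pseudo-inverse as a function on the unit interval, set to `0` at the end points. -/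
def unitPseudoInverse (γ : Measure ℝ) (x : I) : ℝ :=
  if (x : ℝ) ∈ Ioo (0 : ℝ) 1 then pseudoInverse γ x else 0

lemma measurable_unitGenerator (γ : Measure ℝ) [IsProbabilityMeasure γ] :
    Measurable (unitGenerator γ) :=
  (continuous_projIcc (h := zero_le_one (α := ℝ))).measurable.comp (measurable_generator γ)

namespace IsWilliamsonMeasure

variable {γ : Measure ℝ}

lemma coe_unitGenerator (hγ : IsWilliamsonMeasure γ) {z : ℝ} (hz : 0 ≤ z) :
    (unitGenerator γ z : ℝ) = generator γ z := by
  rw [unitGenerator, projIcc_of_mem zero_le_one ⟨generator_nonneg γ z, hγ.generator_le_one hz⟩]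

lemma unitGenerator_le_iff (hγ : IsWilliamsonMeasure γ) {y : I} {z : ℝ}
    (hy : (y : ℝ) ∈ Ioo (0 : ℝ) 1) (hz : 0 ≤ z) :
    unitGenerator γ z ≤ y ↔ pseudoInverse γ y ≤ z := by
  rw [← hγ.generator_le_iff hy hz, ← hγ.coe_unitGenerator hz, Subtype.coe_le_coe]

lemma unitPseudoInverse_unitGenerator (hγ : IsWilliamsonMeasure γ) {z : ℝ} (hz : 0 < z)
    (hpos : 0 < generator γ z) : unitPseudoInverse γ (unitGenerator γ z) = z := by
  rw [unitPseudoInverse, hγ.coe_unitGenerator hz.le, if_pos (hγ.generator_mem_Ioo hz hpos),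
    hγ.pseudoInverse_generator hz.le hpos]

lemma measurable_unitPseudoInverse (hγ : IsWilliamsonMeasure γ) :
    Measurable (unitPseudoInverse γ) := by
  have := hγ.isProbabilityMeasure
  have hIoo : MeasurableSet {x : I | (x : ℝ) ∈ Ioo (0 : ℝ) 1} :=
    measurable_subtype_coe measurableSet_Ioo
  refine measurable_of_Iic fun c => ?_
  rcases lt_or_ge c 0 with hc | hc
  · convert MeasurableSet.empty using 1
    refine eq_empty_of_forall_notMem fun x (hx : unitPseudoInverse γ x ≤ c) => ?_
    rw [unitPseudoInverse] at hx
    split_ifs at hx with h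
    · exact absurd (hγ.pseudoInverse_pos h) (hx.trans hc.le).not_gt
    · exact hx.not_gt hc
  · have : unitPseudoInverse γ ⁻¹' Iic c =
        {x : I | (x : ℝ) ∈ Ioo (0 : ℝ) 1}ᶜ ∪ {x : I | generator γ c ≤ x} := by
      ext x
      simp only [mem_preimage, mem_Iic, mem_union, mem_compl_iff, mem_ofPred_eq]
      by_cases h : (x : ℝ) ∈ Ioo (0 : ℝ) 1
      · rw [unitPseudoInverse, if_pos h, ← hγ.generator_le_iff h hc]
        simp [h]
      · rw [unitPseudoInverse, if_neg h]
        simp [h, hc]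
    rw [this]
    exact hIoo.compl.union (measurableSet_le measurable_const measurable_subtype_coe)

lemma generatorRate_ne_top (hγ : IsWilliamsonMeasure γ) {z : ℝ} (hz : 0 < z) :
    generatorRate γ z ≠ ∞ := by
  have := hγ.isProbabilityMeasure
  refine ((lintegral_mono (g := fun _ => ENNReal.ofReal z⁻¹) fun t => ?_).trans_lt ?_).ne
  · split_ifs with h
    · rw [← one_div]
      exact ENNReal.ofReal_le_ofReal ((lt_div_iff₀ hz).2 h).le
    · exact zero_le
  · simp

/-- Both sides say that `γ` charges `{t | t z < 1}`. -/
lemma generatorRate_ne_zero_iff (hγ : IsWilliamsonMeasure γ) {z : ℝ} (hz : 0 ≤ z) :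
    generatorRate γ z ≠ 0 ↔ 0 < generator γ z := by
  have hmeas : MeasurableSet {t : ℝ | t * z < 1} := measurableSet_lt (by fun_prop) (by fun_prop)
  rw [hγ.generator_pos_iff hz, generatorRate, ne_eq, ne_eq,
    lintegral_eq_zero_iff (Measurable.ite hmeas (by fun_prop) measurable_const)]
  refine not_congr ⟨fun h => ?_, fun h => ?_⟩
  · rw [measure_eq_zero_iff_ae_notMem]
    filter_upwards [h, hγ.ae_pos] with t h1 h2 (h3 : t * z < 1)
    rw [if_pos h3, Pi.zero_apply, ENNReal.ofReal_eq_zero] at h1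
    exact h1.not_gt h2
  · filter_upwards [measure_eq_zero_iff_ae_notMem.1 h] with t ht
    exact if_neg ht

end IsWilliamsonMeasure

/-! ### The conditional measures -/

section

variable {γ : Measure ℝ} {ϑ : Measure I}

lemma measurable_conditionalDensity : Measurable fun q : ℝ × (ℝ × I) =>
    if q.2.1 * q.1 < 1 then ENNReal.ofReal (q.2.1 * (2 * (1 - (q.2.2 : ℝ)))) else 0 :=
  Measurable.ite (measurableSet_lt (by fun_prop) (by fun_prop)) (by fun_prop) measurable_const

lemma conditionalMeasure_apply {z : ℝ} {S : Set (ℝ × I)} (hS : MeasurableSet S) :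
    conditionalMeasure γ ϑ z S = ∫⁻ p, S.indicator (fun p : ℝ × I =>
      if p.1 * z < 1 then ENNReal.ofReal (p.1 * (2 * (1 - (p.2 : ℝ)))) else 0) p ∂γ.prod ϑ := by
  rw [conditionalMeasure, withDensity_apply _ hS, lintegral_indicator hS]

lemma measurable_conditionalMeasure_section [SFinite γ] [SFinite ϑ] {P : ℝ → ℝ × I → Prop}
    (hP : MeasurableSet {q : ℝ × (ℝ × I) | P q.1 q.2}) :
    Measurable fun z => conditionalMeasure γ ϑ z {p | P z p} := by
  have h := (measurable_conditionalDensity.indicator hP).lintegral_prod_right' (ν := γ.prod ϑ)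
  convert h using 2 with z
  have hz : MeasurableSet {p | P z p} := measurable_prodMk_left (x := z) hP
  rw [conditionalMeasure_apply hz]
  rfl

lemma measurable_generatorRate [SFinite γ] : Measurable (generatorRate γ) := by
  have : Measurable fun q : ℝ × ℝ => if q.2 * q.1 < 1 then ENNReal.ofReal q.2 else 0 :=
    Measurable.ite (measurableSet_lt (by fun_prop) (by fun_prop)) (by fun_prop) measurable_const
  exact this.lintegral_prod_right'

lemma conditionalMeasure_univ [SFinite γ] (hϑ : IsPickandsMeasure ϑ) (z : ℝ) :
    conditionalMeasure γ ϑ z univ = generatorRate γ z := by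
  have := hϑ.isProbabilityMeasure
  have hm : Measurable fun p : ℝ × I =>
      if p.1 * z < 1 then ENNReal.ofReal (p.1 * (2 * (1 - (p.2 : ℝ)))) else 0 :=
    measurable_conditionalDensity.comp (measurable_prodMk_left (x := z))
  rw [conditionalMeasure, withDensity_apply _ .univ, Measure.restrict_univ,
    lintegral_prod _ hm.aemeasurable]
  refine lintegral_congr fun t => ?_
  by_cases h : t * z < 1
  · simp only [if_pos h]
    have h1 : ∀ s : I, ENNReal.ofReal (t * (2 * (1 - (s : ℝ)))) =
        ENNReal.ofReal t * ENNReal.ofReal (2 * (1 - (s : ℝ))) := fun s =>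
      ENNReal.ofReal_mul' (mul_nonneg zero_le_two (by linarith [s.2.2]))
    simp only [h1]
    rw [lintegral_const_mul' _ _ ENNReal.ofReal_ne_top, hϑ.lintegral_two_mul, mul_one]
  · simp [h]

lemma measurableSet_le_levelPoint (hϑ : IsPickandsMeasure ϑ) (w : ℝ) :
    MeasurableSet {q : ℝ × (ℝ × I) | w ≤ levelPoint ϑ q.1 q.2.1 q.2.2} :=
  measurableSet_le measurable_const hϑ.measurable_levelPoint

/-- The computational core: integrating over `z` before `t` leaves `(1 - t ℓ(z₁,w))₊`, whose
`γ`-integral is `ψ(ℓ(z₁,w))`. With `z₁ = φ(x)` and `w = φ(y)` this is the copula. -/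
lemma lintegral_conditionalMeasure (hγ : IsWilliamsonMeasure γ) (hϑ : IsPickandsMeasure ϑ)
    {z₁ w : ℝ} (hz₁ : 0 ≤ z₁) (hw : 0 ≤ w) :
    ∫⁻ z in Ioi z₁, conditionalMeasure γ ϑ z {p | w ≤ levelPoint ϑ z p.1 p.2} =
      ENNReal.ofReal (generator γ (tailFunction ϑ z₁ w)) := by
  have := hγ.isProbabilityMeasure
  have := hϑ.isProbabilityMeasure
  have hE := measurableSet_le_levelPoint hϑ w
  have hlt : MeasurableSet {q : ℝ × (ℝ × I) | q.2.1 * q.1 < 1} :=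
    measurableSet_lt (by fun_prop) (by fun_prop)
  have hmeas : Measurable fun q : ℝ × (ℝ × I) => if q.2.1 * q.1 < 1 ∧
      w ≤ levelPoint ϑ q.1 q.2.1 q.2.2 then
        ENNReal.ofReal (q.2.1 * (2 * (1 - (q.2.2 : ℝ)))) else 0 :=
    Measurable.ite (hlt.inter hE) (by fun_prop) measurable_const
  have h1 : ∀ z, conditionalMeasure γ ϑ z {p | w ≤ levelPoint ϑ z p.1 p.2} =
      ∫⁻ t, ∫⁻ s : I, (if t * z < 1 ∧ w ≤ levelPoint ϑ z t s then
        ENNReal.ofReal (t * (2 * (1 - (s : ℝ)))) else 0) ∂ϑ ∂γ := fun z => by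
    have hEz : MeasurableSet {p : ℝ × I | w ≤ levelPoint ϑ z p.1 p.2} := measurable_prodMk_left hE
    rw [conditionalMeasure_apply hEz,
      ← lintegral_prod (fun p : ℝ × I => if p.1 * z < 1 ∧ w ≤ levelPoint ϑ z p.1 p.2 then
        ENNReal.ofReal (p.1 * (2 * (1 - (p.2 : ℝ)))) else 0)
        (hmeas.comp measurable_prodMk_left).aemeasurable]
    refine lintegral_congr fun p => ?_
    by_cases h2 : w ≤ levelPoint ϑ z p.1 p.2
    · rw [indicator_of_mem (show p ∈ {p : ℝ × I | w ≤ levelPoint ϑ z p.1 p.2} from h2)]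
      simp only [h2, and_true]
    · rw [indicator_of_notMem (show p ∉ {p : ℝ × I | w ≤ levelPoint ϑ z p.1 p.2} from h2)]
      simp only [h2, and_false, if_false]
  simp only [h1]
  have hmeas2 : Measurable fun q : (ℝ × ℝ) × I => if q.1.2 * q.1.1 < 1 ∧
      w ≤ levelPoint ϑ q.1.1 q.1.2 q.2 then
        ENNReal.ofReal (q.1.2 * (2 * (1 - (q.2 : ℝ)))) else 0 :=
    hmeas.comp MeasurableEquiv.prodAssoc.measurable
  rw [lintegral_lintegral_swap (hmeas2.lintegral_prod_right' (ν := ϑ)).aemeasurable,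
    hγ.ofReal_generator (hz₁.trans (hϑ.left_le_tailFunction hz₁ hw))]
  refine lintegral_congr_ae ?_
  filter_upwards [hγ.ae_pos] with t ht
  exact hϑ.lintegral_levelPoint hz₁ ht hw

lemma lintegral_generatorRate (hγ : IsWilliamsonMeasure γ) (hϑ : IsPickandsMeasure ϑ)
    {z₁ : ℝ} (hz₁ : 0 ≤ z₁) :
    ∫⁻ z in Ioi z₁, generatorRate γ z = ENNReal.ofReal (generator γ z₁) := by
  have := hγ.isProbabilityMeasure
  have h := lintegral_conditionalMeasure hγ hϑ hz₁ le_rfl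
  have h1 : ∀ z : ℝ, {p : ℝ × I | 0 ≤ levelPoint ϑ z p.1 p.2} = univ := fun z =>
    eq_univ_of_forall fun p => levelPoint_nonneg ϑ z p.1 p.2
  simpa only [h1, conditionalMeasure_univ hϑ, hϑ.tailFunction_zero_right hz₁] using h

end

/-- A finite measure on the unit interval whose distribution function is the identity on `(0,1)`
does not charge `0`. -/
lemma measure_Iic_zero_of_le {κ : Measure I}
    (h : ∀ y : I, (y : ℝ) ∈ Ioo (0 : ℝ) 1 → κ (Iic y) ≤ ENNReal.ofReal y) : κ (Iic 0) = 0 := by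
  refine le_antisymm (ENNReal.le_of_forall_pos_le_add fun ε hε _ => ?_) zero_le
  rw [zero_add]
  set y : I := ⟨min (ε : ℝ) (1 / 2), le_min ε.2 (by norm_num),
    (min_le_right _ _).trans (by norm_num)⟩
  have hy : (y : ℝ) ∈ Ioo (0 : ℝ) 1 :=
    ⟨lt_min hε (by norm_num), (min_le_right _ _).trans_lt (by norm_num)⟩
  refine (measure_mono (Iic_subset_Iic.2 (show (0 : I) ≤ y from y.2.1))).trans ((h y hy).trans ?_)
  rw [← ENNReal.ofReal_coe_nnreal]
  exact ENNReal.ofReal_le_ofReal (min_le_left _ _)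

/-- The generator transports its rate to the Lebesgue measure. -/
lemma map_unitGenerator {γ : Measure ℝ} {ϑ : Measure I} (hγ : IsWilliamsonMeasure γ)
    (hϑ : IsPickandsMeasure ϑ) :
    ((volume.restrict (Ioi 0)).withDensity (generatorRate γ)).map (unitGenerator γ) = volume := by
  have := hγ.isProbabilityMeasure
  have htot := lintegral_generatorRate hγ hϑ le_rfl
  rw [hγ.generator_zero, ENNReal.ofReal_one] at htot
  have hfin : IsFiniteMeasure ((volume.restrict (Ioi 0)).withDensity (generatorRate γ)) :=
    isFiniteMeasure_withDensity (htot ▸ ENNReal.one_ne_top)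
  have hIoo : ∀ y : I, (y : ℝ) ∈ Ioo (0 : ℝ) 1 →
      ((volume.restrict (Ioi 0)).withDensity (generatorRate γ)).map (unitGenerator γ) (Iic y) =
        ENNReal.ofReal y := fun y hy => by
    have hy0 := hγ.pseudoInverse_pos hy
    have hset : unitGenerator γ ⁻¹' Iic y ∩ Ioi 0 = Ici (pseudoInverse γ y) := by
      ext z
      refine ⟨fun h => (hγ.unitGenerator_le_iff hy (le_of_lt h.2)).1 h.1, fun h => ?_⟩
      have hz : 0 < z := hy0.trans_le h
      exact ⟨(hγ.unitGenerator_le_iff hy hz.le).2 h, hz⟩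
    have hm : MeasurableSet (unitGenerator γ ⁻¹' Iic y) :=
      measurable_unitGenerator γ measurableSet_Iic
    rw [Measure.map_apply (measurable_unitGenerator γ) measurableSet_Iic, withDensity_apply _ hm,
      Measure.restrict_restrict hm, hset, setLIntegral_congr Ioi_ae_eq_Ici.symm,
      lintegral_generatorRate hγ hϑ hy0.le, hγ.generator_pseudoInverse hy]
  -- `φ` is only meaningful on `(0,1)`: the value at `0` is squeezed from nearby points, the value
  -- at `1` is the total mass `ψ(0) = 1`.
  refine Measure.ext_of_Iic _ _ fun x => ?_
  rw [unitInterval.volume_Iic]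
  rcases x.2.1.eq_or_lt with h0 | h0
  · have : x = 0 := Subtype.ext h0.symm
    rw [this, measure_Iic_zero_of_le fun y hy => (hIoo y hy).le]
    simp
  rcases x.2.2.eq_or_lt with h1 | h1
  · have : x = 1 := Subtype.ext h1
    have h2 : Iic x = univ := eq_univ_of_forall fun y => this ▸ y.2.2
    rw [h2, Measure.map_apply (measurable_unitGenerator γ) .univ, preimage_univ,
      withDensity_apply _ .univ, Measure.restrict_univ, htot, h1, ENNReal.ofReal_one]
  · exact hIoo x ⟨h0, h1⟩

/-! ### The Markov kernel of an Archimax copula -/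

variable {γ : Measure ℝ} {ϑ : Measure I}

/-- The second coordinate of the copula as a function of the mixing variables. -/
def unitLevel (γ : Measure ℝ) (ϑ : Measure I) (z : ℝ) (p : ℝ × I) : I :=
  unitGenerator γ (levelPoint ϑ z p.1 p.2)

lemma measurable_unitLevel [IsProbabilityMeasure γ] (hϑ : IsPickandsMeasure ϑ) :
    Measurable fun q : ℝ × (ℝ × I) => unitLevel γ ϑ q.1 q.2 :=
  (measurable_unitGenerator γ).comp hϑ.measurable_levelPoint

lemma measurable_unitLevel_right [IsProbabilityMeasure γ] (hϑ : IsPickandsMeasure ϑ) (z : ℝ) :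
    Measurable (unitLevel γ ϑ z) := by
  have h := (measurable_unitLevel (γ := γ) hϑ).comp (measurable_prodMk_left (x := z))
  simpa only [Function.comp_def] using h

/-- The conditional law of the second coordinate given that the first one is `ψ(z)`. -/
def conditionalLaw (γ : Measure ℝ) (ϑ : Measure I) (z : ℝ) : Measure I :=
  (generatorRate γ z)⁻¹ • (conditionalMeasure γ ϑ z).map (unitLevel γ ϑ z)

lemma conditionalLaw_apply [IsProbabilityMeasure γ] (hϑ : IsPickandsMeasure ϑ) (z : ℝ)
    {B : Set I} (hB : MeasurableSet B) : conditionalLaw γ ϑ z B =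
      (generatorRate γ z)⁻¹ * conditionalMeasure γ ϑ z {p | unitLevel γ ϑ z p ∈ B} := by
  rw [conditionalLaw, Measure.smul_apply, smul_eq_mul,
    Measure.map_apply (measurable_unitLevel_right hϑ z) hB]
  rfl

lemma measurable_conditionalLaw [IsProbabilityMeasure γ] (hϑ : IsPickandsMeasure ϑ) :
    Measurable (conditionalLaw γ ϑ) := by
  have := hϑ.isProbabilityMeasure
  refine Measure.measurable_of_measurable_coe _ fun B hB => ?_
  simp only [conditionalLaw_apply hϑ _ hB]
  have hE : MeasurableSet {q : ℝ × (ℝ × I) | unitLevel γ ϑ q.1 q.2 ∈ B} :=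
    measurable_unitLevel hϑ hB
  have h : Measurable fun z => conditionalMeasure γ ϑ z {p | unitLevel γ ϑ z p ∈ B} :=
    measurable_conditionalMeasure_section (P := fun z p => unitLevel γ ϑ z p ∈ B) hE
  exact measurable_generatorRate.inv.mul h

/-- The bound needs no condition on the rate: if it is `0` or `∞`, the product with its inverse is
`0`. This covers the value `z = 0` assigned to the end points of the unit interval. -/
lemma conditionalLaw_univ_le [IsProbabilityMeasure γ] (hϑ : IsPickandsMeasure ϑ) (z : ℝ) :
    conditionalLaw γ ϑ z univ ≤ 1 := by
  rw [conditionalLaw_apply hϑ z .univ]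
  simp only [mem_univ]
  rw [show {p : ℝ × I | True} = univ from eq_univ_of_forall fun _ => trivial,
    conditionalMeasure_univ hϑ]
  exact ENNReal.inv_mul_le_one _

/-- An explicit version of the Markov kernel of the Archimax copula. -/
def archimaxKernel (hγ : IsWilliamsonMeasure γ) (hϑ : IsPickandsMeasure ϑ) : Kernel I I where
  toFun x := conditionalLaw γ ϑ (unitPseudoInverse γ x)
  measurable' := by
    have := hγ.isProbabilityMeasure
    exact (measurable_conditionalLaw hϑ).comp hγ.measurable_unitPseudoInverse

lemma archimaxKernel_apply (hγ : IsWilliamsonMeasure γ) (hϑ : IsPickandsMeasure ϑ) (x : I) :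
    archimaxKernel hγ hϑ x = conditionalLaw γ ϑ (unitPseudoInverse γ x) := rfl

instance (hγ : IsWilliamsonMeasure γ) (hϑ : IsPickandsMeasure ϑ) :
    IsFiniteKernel (archimaxKernel hγ hϑ) := by
  have := hγ.isProbabilityMeasure
  exact ⟨⟨1, ENNReal.one_lt_top, fun x => conditionalLaw_univ_le hϑ _⟩⟩

/-- Substituting `x = ψ(z)` produces the density `generatorRate`, which cancels the normalization of
the conditional law; where the rate is `0`, both integrands vanish. -/
lemma setLIntegral_archimaxKernel (hγ : IsWilliamsonMeasure γ) (hϑ : IsPickandsMeasure ϑ)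
    {A B : Set I} (hA : MeasurableSet A) (hB : MeasurableSet B) :
    ∫⁻ x in A, archimaxKernel hγ hϑ x B = ∫⁻ z in unitGenerator γ ⁻¹' A ∩ Ioi 0,
      conditionalMeasure γ ϑ z {p | unitLevel γ ϑ z p ∈ B} := by
  have := hγ.isProbabilityMeasure
  have := hϑ.isProbabilityMeasure
  have hmeas : Measurable fun x => archimaxKernel hγ hϑ x B := Kernel.measurable_coe _ hB
  have hA' := measurable_unitGenerator γ hA
  have hcomp : Measurable fun z =>
      A.indicator (fun x => archimaxKernel hγ hϑ x B) (unitGenerator γ z) :=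
    (hmeas.indicator hA).comp (measurable_unitGenerator γ)
  rw [← lintegral_indicator hA, ← map_unitGenerator hγ hϑ,
    lintegral_map (hmeas.indicator hA) (measurable_unitGenerator γ),
    lintegral_withDensity_eq_lintegral_mul _ measurable_generatorRate hcomp,
    ← Measure.restrict_restrict hA', ← lintegral_indicator hA']
  refine setLIntegral_congr_fun measurableSet_Ioi fun z hz => ?_
  have hz0 : (0 : ℝ) < z := hz
  rw [Pi.mul_apply]
  by_cases hzA : unitGenerator γ z ∈ A
  · rw [indicator_of_mem hzA, indicator_of_mem (show z ∈ unitGenerator γ ⁻¹' A from hzA)]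
    by_cases h0 : generatorRate γ z = 0
    · rw [h0, zero_mul]
      exact (measure_mono_null (subset_univ _)
        ((conditionalMeasure_univ hϑ z).trans h0)).symm
    · rw [archimaxKernel_apply, hγ.unitPseudoInverse_unitGenerator hz0
        ((hγ.generatorRate_ne_zero_iff hz0.le).1 h0), conditionalLaw_apply hϑ z hB, ← mul_assoc,
        ENNReal.mul_inv_cancel h0 (hγ.generatorRate_ne_top hz0), one_mul]
  · rw [indicator_of_notMem hzA,
      indicator_of_notMem (show z ∉ unitGenerator γ ⁻¹' A from hzA), mul_zero]

lemma unitLevel_mem_Iic (hγ : IsWilliamsonMeasure γ) {y : I} (hy : (y : ℝ) ∈ Ioo (0 : ℝ) 1)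
    (z : ℝ) : {p | unitLevel γ ϑ z p ∈ Iic y} =
      {p | pseudoInverse γ y ≤ levelPoint ϑ z p.1 p.2} := by
  ext p
  exact hγ.unitGenerator_le_iff hy (levelPoint_nonneg ϑ z p.1 p.2)

lemma compProd_archimaxKernel (hγ : IsWilliamsonMeasure γ) (hϑ : IsPickandsMeasure ϑ)
    {x y : I} (hx : (x : ℝ) ∈ Ioo (0 : ℝ) 1) (hy : (y : ℝ) ∈ Ioo (0 : ℝ) 1) :
    (volume ⊗ₘ archimaxKernel hγ hϑ) (Iic x ×ˢ Iic y) =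
      ENNReal.ofReal (archimaxCopula γ ϑ x y) := by
  have hx0 := hγ.pseudoInverse_pos hx
  have hy0 := hγ.pseudoInverse_pos hy
  have hset : unitGenerator γ ⁻¹' Iic x ∩ Ioi 0 = Ici (pseudoInverse γ x) := by
    ext z
    refine ⟨fun h => (hγ.unitGenerator_le_iff hx (le_of_lt h.2)).1 h.1, fun h => ?_⟩
    have hz : 0 < z := hx0.trans_le h
    exact ⟨(hγ.unitGenerator_le_iff hx hz.le).2 h, hz⟩
  rw [Measure.compProd_apply_prod measurableSet_Iic measurableSet_Iic,
    setLIntegral_archimaxKernel hγ hϑ measurableSet_Iic measurableSet_Iic, hset,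
    setLIntegral_congr Ioi_ae_eq_Ici.symm]
  simp only [unitLevel_mem_Iic hγ hy]
  rw [lintegral_conditionalMeasure hγ hϑ hx0.le hy0.le, archimaxCopula, if_pos ⟨hx, hy⟩,
    hϑ.mul_pickandsFunction hx0 hy0]

lemma compProd_archimaxKernel_univ_left (hγ : IsWilliamsonMeasure γ) (hϑ : IsPickandsMeasure ϑ)
    {y : I} (hy : (y : ℝ) ∈ Ioo (0 : ℝ) 1) :
    (volume ⊗ₘ archimaxKernel hγ hϑ) (univ ×ˢ Iic y) = ENNReal.ofReal y := by
  have hy0 := hγ.pseudoInverse_pos hy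
  rw [Measure.compProd_apply_prod .univ measurableSet_Iic,
    setLIntegral_archimaxKernel hγ hϑ .univ measurableSet_Iic, preimage_univ, univ_inter]
  simp only [unitLevel_mem_Iic hγ hy]
  rw [lintegral_conditionalMeasure hγ hϑ le_rfl hy0.le, hϑ.tailFunction_zero_left hy0.le,
    hγ.generator_pseudoInverse hy]

lemma unitPseudoInverse_pos (hγ : IsWilliamsonMeasure γ) {x : I}
    (hx : (x : ℝ) ∈ Ioo (0 : ℝ) 1) : 0 < unitPseudoInverse γ x := by
  rw [unitPseudoInverse, if_pos hx]
  exact hγ.pseudoInverse_pos hx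

lemma generatorRate_unitPseudoInverse_ne_zero (hγ : IsWilliamsonMeasure γ) {x : I}
    (hx : (x : ℝ) ∈ Ioo (0 : ℝ) 1) : generatorRate γ (unitPseudoInverse γ x) ≠ 0 := by
  rw [hγ.generatorRate_ne_zero_iff (unitPseudoInverse_pos hγ hx).le, unitPseudoInverse, if_pos hx,
    hγ.generator_pseudoInverse hx]
  exact hx.1

lemma archimaxKernel_univ (hγ : IsWilliamsonMeasure γ) (hϑ : IsPickandsMeasure ϑ) {x : I}
    (hx : (x : ℝ) ∈ Ioo (0 : ℝ) 1) : archimaxKernel hγ hϑ x univ = 1 := by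
  have := hγ.isProbabilityMeasure
  rw [archimaxKernel_apply, conditionalLaw_apply hϑ _ .univ]
  simp only [mem_univ]
  rw [show {p : ℝ × I | True} = univ from eq_univ_of_forall fun _ => trivial,
    conditionalMeasure_univ hϑ]
  exact ENNReal.inv_mul_cancel (generatorRate_unitPseudoInverse_ne_zero hγ hx)
    (hγ.generatorRate_ne_top (unitPseudoInverse_pos hγ hx))

lemma ae_mem_Ioo : ∀ᵐ x : I, (x : ℝ) ∈ Ioo (0 : ℝ) 1 := by
  have h0 : ∀ᵐ x : I, x ∉ ({0} : Set I) := measure_eq_zero_iff_ae_notMem.1 (by simp)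
  have h1 : ∀ᵐ x : I, x ∉ ({1} : Set I) := measure_eq_zero_iff_ae_notMem.1 (by simp)
  filter_upwards [h0, h1] with x hx0 hx1
  exact ⟨x.2.1.lt_of_ne fun h => hx0 (Subtype.ext h.symm),
    x.2.2.lt_of_ne fun h => hx1 (Subtype.ext h)⟩

lemma compProd_archimaxKernel_univ_right (hγ : IsWilliamsonMeasure γ)
    (hϑ : IsPickandsMeasure ϑ) {A : Set I} (hA : MeasurableSet A) :
    (volume ⊗ₘ archimaxKernel hγ hϑ) (A ×ˢ univ) = volume A := by
  rw [Measure.compProd_apply_prod hA .univ]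
  have : ∀ᵐ x ∂volume.restrict A, archimaxKernel hγ hϑ x univ = 1 := by
    filter_upwards [ae_restrict_of_ae ae_mem_Ioo] with x hx using archimaxKernel_univ hγ hϑ hx
  rw [lintegral_congr_ae this]
  simp

lemma compProd_archimaxKernel_Iic_zero (hγ : IsWilliamsonMeasure γ)
    (hϑ : IsPickandsMeasure ϑ) :
    (volume ⊗ₘ archimaxKernel hγ hϑ) (univ ×ˢ Iic 0) = 0 := by
  have h : ∀ B : Set I, MeasurableSet B → (volume ⊗ₘ archimaxKernel hγ hϑ) (univ ×ˢ B) =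
      ((volume ⊗ₘ archimaxKernel hγ hϑ).map Prod.snd) B := fun B hB => by
    rw [Measure.map_apply measurable_snd hB, univ_prod]
  rw [h _ measurableSet_Iic]
  refine measure_Iic_zero_of_le fun y hy => ?_
  rw [← h _ measurableSet_Iic, compProd_archimaxKernel_univ_left hγ hϑ hy]

lemma isCopulaMeasure_compProd (hγ : IsWilliamsonMeasure γ) (hϑ : IsPickandsMeasure ϑ) :
    IsCopulaMeasure (archimaxCopula γ ϑ) (volume ⊗ₘ archimaxKernel hγ hϑ) := by
  have hone : Iic (1 : I) = univ := eq_univ_of_forall fun y => y.2.2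
  intro x y
  by_cases hxy : (x : ℝ) ∈ Ioo (0 : ℝ) 1 ∧ (y : ℝ) ∈ Ioo (0 : ℝ) 1
  · exact compProd_archimaxKernel hγ hϑ hxy.1 hxy.2
  rw [archimaxCopula, if_neg hxy]
  -- On the boundary the formula plays no role; the values follow from the two uniform margins.
  rcases x.2.1.eq_or_lt with hx0 | hx0
  · rw [show x = 0 from Subtype.ext hx0.symm]
    refine (measure_mono_null (prod_mono_right (subset_univ _)) ?_).trans ?_
    · rw [compProd_archimaxKernel_univ_right hγ hϑ measurableSet_Iic, unitInterval.volume_Iic]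
      simp
    · simp [y.2.1]
  rcases y.2.1.eq_or_lt with hy0 | hy0
  · rw [show y = 0 from Subtype.ext hy0.symm]
    refine (measure_mono_null (prod_mono_left (subset_univ _))
      (compProd_archimaxKernel_Iic_zero hγ hϑ)).trans ?_
    simp [x.2.1]
  rcases y.2.2.eq_or_lt with hy1 | hy1
  · rw [show y = 1 from Subtype.ext hy1, hone,
      compProd_archimaxKernel_univ_right hγ hϑ measurableSet_Iic, unitInterval.volume_Iic]
    simp [x.2.2]
  · have hx1 : (x : ℝ) = 1 := x.2.2.antisymm (not_lt.1 fun h => hxy ⟨⟨hx0, h⟩, hy0, hy1⟩)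
    rw [show x = 1 from Subtype.ext hx1, hone,
      compProd_archimaxKernel_univ_left hγ hϑ ⟨hy0, hy1⟩]
    simp [y.2.2]

lemma archimaxCopula_nonneg (γ : Measure ℝ) (ϑ : Measure I) (x y : I) :
    0 ≤ archimaxCopula γ ϑ x y := by
  rw [archimaxCopula]
  split_ifs
  exacts [generator_nonneg _ _, le_min x.2.1 y.2.1]

/-- A function on the unit square given by a measure is `2`-increasing. -/
lemma IsCopulaMeasure.two_increasing {C : I → I → ℝ} {μ : Measure (I × I)}
    (h : IsCopulaMeasure C μ) (hC : ∀ x y, 0 ≤ C x y) {x x' y y' : I} (hx : x ≤ x')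
    (hy : y ≤ y') : 0 ≤ C x' y' - C x y' - C x' y + C x y := by
  have := h.isFiniteMeasure
  have hr : ∀ x y, μ.real (Iic x ×ˢ Iic y) = C x y := fun x y => by
    rw [Measure.real, h x y, ENNReal.toReal_ofReal (hC x y)]
  have hm : MeasurableSet (Iic x ×ˢ Iic y') := measurableSet_Iic.prod measurableSet_Iic
  have hunion := measureReal_union_add_inter (μ := μ) (s := Iic x' ×ˢ Iic y) hm
  have hinter : (Iic x' ×ˢ Iic y) ∩ (Iic x ×ˢ Iic y') = Iic x ×ˢ Iic y := by
    rw [prod_inter_prod, Iic_inter_Iic, Iic_inter_Iic, inf_eq_right.2 hx, inf_eq_left.2 hy]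
  have hle : μ.real ((Iic x' ×ˢ Iic y) ∪ (Iic x ×ˢ Iic y')) ≤ μ.real (Iic x' ×ˢ Iic y') :=
    measureReal_mono (union_subset (prod_mono_right (Iic_subset_Iic.2 hy))
      (prod_mono_left (Iic_subset_Iic.2 hx)))
  rw [hinter, hr, hr, hr] at hunion
  rw [hr] at hle
  linarith

lemma isCopula_archimaxCopula (hγ : IsWilliamsonMeasure γ) (hϑ : IsPickandsMeasure ϑ) :
    IsCopula (archimaxCopula γ ϑ) where
  zero_left y := by simp [archimaxCopula, y.2.1]
  zero_right x := by simp [archimaxCopula, x.2.1]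
  one_left y := by simp [archimaxCopula, y.2.2]
  one_right x := by simp [archimaxCopula, x.2.2]
  two_increasing _ _ _ _ hx hy := (isCopulaMeasure_compProd hγ hϑ).two_increasing
    (archimaxCopula_nonneg γ ϑ) hx hy

/-- The explicit kernel disintegrates the same measure over the same first margin, so almost
everywhere uniqueness applies. -/
lemma markovKernel_archimaxCopula (hγ : IsWilliamsonMeasure γ) (hϑ : IsPickandsMeasure ϑ) :
    ∀ᵐ x : I, archimaxKernel hγ hϑ x = markovKernel (archimaxCopula γ ϑ) x := by
  have h := (isCopulaMeasure_compProd hγ hϑ).copulaMeasure_eq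
  have hfst : (copulaMeasure (archimaxCopula γ ϑ)).fst = volume := by
    ext A hA
    rw [Measure.fst_apply hA, ← prod_univ, h, compProd_archimaxKernel_univ_right hγ hϑ hA]
  have key := eq_condKernel_of_measure_eq_compProd (ρ := copulaMeasure (archimaxCopula γ ϑ))
    (archimaxKernel hγ hϑ) (by rw [hfst, h])
  rwa [hfst] at key

/-- Needed because `0` is the only value that `ψ` can take on a whole interval of levels; elsewhere
`ψ` is injective. -/
lemma archimaxKernel_singleton_zero (hγ : IsWilliamsonMeasure γ) (hϑ : IsPickandsMeasure ϑ) :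
    ∀ᵐ x : I, archimaxKernel hγ hϑ x {0} = 0 := by
  have h := compProd_archimaxKernel_Iic_zero hγ hϑ
  have h0 : Iic (0 : I) = {0} := by
    ext y
    exact ⟨fun h => le_antisymm h y.2.1, fun h => le_of_eq h⟩
  rw [Measure.compProd_apply_prod .univ measurableSet_Iic, h0, Measure.restrict_univ,
    lintegral_eq_zero_iff (Kernel.measurable_coe _ (measurableSet_singleton 0))] at h
  exact h

/-! ### Regularity of the conditional laws -/

lemma convexOn_div_add {z : ℝ} (hz : 0 < z) : ConvexOn ℝ (Ioi 0) fun w : ℝ => z / (z + w) := by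
  have h := ((convexOn_inv_Ioi.translate_right z).subset
    (fun w (hw : 0 < w) => (add_pos hz hw : 0 < z + w)) (convex_Ioi 0)).smul hz.le
  exact h

lemma strictAntiOn_div_add {z : ℝ} (hz : 0 < z) :
    StrictAntiOn (fun w : ℝ => z / (z + w)) (Ioi 0) := fun a ha b _ hab =>
  div_lt_div_of_pos_left hz (add_pos hz ha) (by linarith)

lemma strictAntiOn_inv_Ioi : StrictAntiOn (fun x : ℝ => x⁻¹) (Ioi 0) := fun _ ha _ hb hab =>
  (inv_lt_inv₀ hb ha).2 hab

lemma volume_coe_preimage_eq_zero {N : Set ℝ} (hN : volume N = 0) :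
    volume ((↑) ⁻¹' N : Set I) = 0 := by
  rw [unitInterval.volume_apply]
  exact measure_mono_null (image_preimage_subset _ _) hN

namespace IsWilliamsonMeasure

lemma isOpen_generator_pos (hγ : IsWilliamsonMeasure γ) :
    IsOpen {w | 0 < w ∧ 0 < generator γ w} :=
  (hγ.continuousOn_generator.mono Ioi_subset_Ici_self).isOpen_inter_preimage isOpen_Ioi isOpen_Ioi

lemma convexOn_generator_pos (hγ : IsWilliamsonMeasure γ) :
    ConvexOn ℝ {w | 0 < w ∧ 0 < generator γ w} (generator γ) := by
  refine hγ.convexOn_generator.subset (fun w hw => le_of_lt hw.1) (OrdConnected.convex ⟨?_⟩)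
  exact fun a ha b hb w hw => ⟨ha.1.trans_le hw.1,
    hb.2.trans_le (hγ.generator_antitoneOn (ha.1.le.trans hw.1) hb.1.le hw.2)⟩

lemma strictAntiOn_generator_pos (hγ : IsWilliamsonMeasure γ) :
    StrictAntiOn (generator γ) {w | 0 < w ∧ 0 < generator γ w} := fun _ ha _ _ hab =>
  hγ.generator_lt ha.1.le hab ha.2

/-- The generator maps null sets of positive numbers to null sets. -/
lemma volume_unitGenerator_image (hγ : IsWilliamsonMeasure γ) {N : Set ℝ} (hpos : N ⊆ Ioi 0)
    (hN : volume N = 0) : volume (unitGenerator γ '' N) = 0 := by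
  have himg : ((↑) '' (unitGenerator γ '' N) : Set ℝ) = generator γ '' N := by
    rw [image_image]
    exact image_congr fun w hw => hγ.coe_unitGenerator (le_of_lt (hpos hw))
  rw [unitInterval.volume_apply, himg]
  exact volume_image_eq_zero_of_convexOn isOpen_Ioi
    (hγ.convexOn_generator.subset Ioi_subset_Ici_self (convex_Ioi 0)) hpos hN

/-- Away from its zeros, the generator pulls null sets back to null sets. -/
lemma volume_unitGenerator_preimage (hγ : IsWilliamsonMeasure γ) {B : Set I}
    (hB : volume B = 0) :
    volume ({w | unitGenerator γ w ∈ B ∧ unitGenerator γ w ≠ 0} ∩ Ioi 0) = 0 := by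
  rw [unitInterval.volume_apply] at hB
  refine measure_mono_null ?_ (volume_preimage_eq_zero_of_strictAntiOn hγ.isOpen_generator_pos
    hγ.convexOn_generator_pos hγ.strictAntiOn_generator_pos hB)
  rintro w ⟨⟨hw, hne⟩, hw0⟩
  have hcoe := hγ.coe_unitGenerator (le_of_lt hw0)
  refine ⟨⟨hw0, (generator_nonneg γ w).lt_of_ne fun h => hne (Subtype.ext ?_)⟩, ?_⟩
  · rw [hcoe, ← h]; rfl
  · exact ⟨_, hw, hcoe⟩

lemma subsingleton_unitGenerator_preimage (hγ : IsWilliamsonMeasure γ) {b : I} (hb : b ≠ 0) :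
    ({w | unitGenerator γ w = b} ∩ Ioi 0).Subsingleton := by
  have hmem : ∀ w ∈ {w | unitGenerator γ w = b} ∩ Ioi 0,
      w ∈ {w | 0 < w ∧ 0 < generator γ w} ∧ generator γ w = b := by
    rintro w ⟨hw, hw0⟩
    have hcoe := hγ.coe_unitGenerator (le_of_lt hw0)
    rw [show unitGenerator γ w = b from hw] at hcoe
    exact ⟨⟨hw0, hcoe ▸ b.2.1.lt_of_ne fun h => hb (Subtype.ext h.symm)⟩, hcoe.symm⟩
  intro v hv w hw
  exact hγ.strictAntiOn_generator_pos.injOn (hmem v hv).1 (hmem w hw).1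
    ((hmem v hv).2.trans (hmem w hw).2.symm)

end IsWilliamsonMeasure

lemma ae_conditionalMeasure (z : ℝ) :
    ∀ᵐ p ∂conditionalMeasure γ ϑ z, 0 < p.1 ∧ p.1 * z < 1 ∧ (p.2 : ℝ) < 1 := by
  have hm : Measurable fun p : ℝ × I =>
      if p.1 * z < 1 then ENNReal.ofReal (p.1 * (2 * (1 - (p.2 : ℝ)))) else 0 :=
    measurable_conditionalDensity.comp (measurable_prodMk_left (x := z))
  rw [conditionalMeasure, ae_withDensity_iff hm]
  refine ae_of_all _ fun p hp => ?_
  have hz : p.1 * z < 1 := by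
    by_contra h
    exact hp (if_neg h)
  rw [if_pos hz, ne_eq, ENNReal.ofReal_eq_zero, not_le] at hp
  have h1 : 0 ≤ 2 * (1 - (p.2 : ℝ)) := mul_nonneg zero_le_two (by linarith [p.2.2.2])
  have h2 := pos_of_mul_pos_left hp h1
  exact ⟨h2, hz, by linarith [pos_of_mul_pos_right hp h2.le]⟩

/-- A set of levels is negligible if so are the sets of mixing variables for which it contains
the solution of one of the two level equations. -/
lemma conditionalMeasure_levelPoint_eq_zero [IsProbabilityMeasure γ] (hϑ : IsPickandsMeasure ϑ)
    {z : ℝ} (hz : 0 < z) {B : Set ℝ}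
    (h1 : γ ((fun w => (tailFunction ϑ z w)⁻¹) ''
      (B ∩ {w | 0 < w ∧ z < tailFunction ϑ z w})) = 0)
    (h2 : ϑ ((↑) ⁻¹' ((fun w => z / (z + w)) '' (B ∩ Ioi 0))) = 0) :
    conditionalMeasure γ ϑ z {p | levelPoint ϑ z p.1 p.2 ∈ B} = 0 := by
  have := hϑ.isProbabilityMeasure
  set T := (fun w => (tailFunction ϑ z w)⁻¹) '' (B ∩ {w | 0 < w ∧ z < tailFunction ϑ z w})
  set S : Set I := (↑) ⁻¹' ((fun w => z / (z + w)) '' (B ∩ Ioi 0))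
  have hac : conditionalMeasure γ ϑ z ≪ γ.prod ϑ := withDensity_absolutelyContinuous _ _
  have hT : conditionalMeasure γ ϑ z (T ×ˢ univ) = 0 :=
    hac (by rw [Measure.prod_prod, h1, zero_mul])
  have hS : conditionalMeasure γ ϑ z (univ ×ˢ S) = 0 :=
    hac (by rw [Measure.prod_prod, h2, mul_zero])
  rw [measure_eq_zero_iff_ae_notMem]
  filter_upwards [ae_conditionalMeasure (γ := γ) (ϑ := ϑ) z, measure_eq_zero_iff_ae_notMem.1 hT,
    measure_eq_zero_iff_ae_notMem.1 hS] with p ⟨ht, htz, hs⟩ hpT hpS hpB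
  have hw : levelPoint ϑ z p.1 p.2 ∈ B := hpB
  have hw0 := hϑ.levelPoint_pos (s := p.2) hz ht htz hs
  -- The active constraint is solved for its mixing variable: `t = 1/ℓ(z,w)` or `s = z/(z+w)`. In
  -- the first case `t z < 1 = t ℓ(z,w)` places `w` where `ℓ(z,·)` is strictly increasing.
  rcases hϑ.levelPoint_spec (s := p.2) hz ht htz with h | h
  · refine hpT ⟨⟨_, ⟨hw, hw0, ?_⟩, (eq_inv_of_mul_eq_one_left h).symm⟩, trivial⟩
    exact lt_of_mul_lt_mul_left (htz.trans_eq h.symm) ht.le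
  · refine hpS ⟨trivial, _, ⟨hw, hw0⟩, ?_⟩
    rw [div_eq_iff (add_pos hz hw0).ne']
    linarith

lemma conditionalLaw_eq_zero [IsProbabilityMeasure γ] (hϑ : IsPickandsMeasure ϑ) (z : ℝ)
    {B : Set I} (hB : MeasurableSet B)
    (h : conditionalMeasure γ ϑ z {p | unitLevel γ ϑ z p ∈ B} = 0) :
    conditionalLaw γ ϑ z B = 0 := by
  rw [conditionalLaw_apply hϑ z hB, h, mul_zero]

/-- The law is negligible on sets `B` without `0` as soon as its mass in `0` is, if the
corresponding set of levels is negligible. -/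
lemma conditionalMeasure_unitLevel_eq_zero [IsProbabilityMeasure γ] (hϑ : IsPickandsMeasure ϑ)
    {z : ℝ} (hrate : generatorRate γ z ≠ ∞) (h0 : conditionalLaw γ ϑ z {0} = 0) {B : Set I}
    (hB : conditionalMeasure γ ϑ z
      {p | levelPoint ϑ z p.1 p.2 ∈ {w | unitGenerator γ w ∈ B ∧ unitGenerator γ w ≠ 0}} = 0) :
    conditionalMeasure γ ϑ z {p | unitLevel γ ϑ z p ∈ B} = 0 := by
  rw [conditionalLaw_apply hϑ z (measurableSet_singleton 0), mul_eq_zero] at h0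
  -- A finite rate has nonzero inverse, so the unnormalized law does not charge the value `0`
  -- either.
  have h0' := h0.resolve_left (ENNReal.inv_ne_zero.2 hrate)
  refine measure_mono_null (fun p hp => ?_) (measure_union_null h0' hB)
  by_cases h : unitLevel γ ϑ z p = 0
  · exact Or.inl h
  · exact Or.inr ⟨hp, h⟩

/-- A null set of values is pulled back by `ψ` to a null set of levels, then pushed forward by
`1/ℓ(z,·)` and `z/(z+·)` to null sets of mixing variables, which `γ` and `ϑ` ignore. -/
lemma conditionalLaw_absolutelyContinuous (hγ : IsWilliamsonMeasure γ)
    (hϑ : IsPickandsMeasure ϑ) {z : ℝ} (hz : 0 < z) (h0 : conditionalLaw γ ϑ z {0} = 0)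
    (hγac : γ ≪ volume) (hϑac : ϑ ≪ volume) : conditionalLaw γ ϑ z ≪ volume := by
  have := hγ.isProbabilityMeasure
  refine Measure.AbsolutelyContinuous.mk fun B hB hB0 => conditionalLaw_eq_zero hϑ z hB
    (conditionalMeasure_unitLevel_eq_zero hϑ (hγ.generatorRate_ne_top hz) h0
      (conditionalMeasure_levelPoint_eq_zero hϑ hz (hγac ?_) (hϑac ?_)))
  all_goals have hN := hγ.volume_unitGenerator_preimage hB0
  · have h1 := volume_image_eq_zero_of_convexOn (hϑ.isOpen_lt_tailFunction z)
      (hϑ.convexOn_tailFunction_lt z) inter_subset_right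
      (measure_mono_null (inter_subset_inter_right _ fun w hw => hw.1) hN)
    have h2 := volume_image_eq_zero_of_convexOn isOpen_Ioi convexOn_inv_Ioi
      (image_subset_iff.2 fun w hw => hz.trans hw.2.2) h1
    rwa [image_image] at h2
  · exact volume_coe_preimage_eq_zero (volume_image_eq_zero_of_convexOn isOpen_Ioi
      (convexOn_div_add hz) inter_subset_right hN)

/-- The levels that solve one of the two level equations for mixing variables in `D` or `D'`. -/
def levelSet (ϑ : Measure I) (z : ℝ) (D : Set ℝ) (D' : Set I) : Set ℝ :=
  {w | 0 < w ∧ z < tailFunction ϑ z w} ∩ (fun w => (tailFunction ϑ z w)⁻¹) ⁻¹' D ∪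
    Ioi 0 ∩ (fun w => z / (z + w)) ⁻¹' ((↑) '' D')

lemma levelSet_subset (z : ℝ) (D : Set ℝ) (D' : Set I) : levelSet ϑ z D D' ⊆ Ioi 0 :=
  union_subset (fun _ hw => hw.1.1) inter_subset_left

lemma injOn_inv_tailFunction (hϑ : IsPickandsMeasure ϑ) {z : ℝ} (hz : 0 < z) :
    InjOn (fun w => (tailFunction ϑ z w)⁻¹) {w | 0 < w ∧ z < tailFunction ϑ z w} :=
  fun _ hv _ hw h => (hϑ.tailFunction_strictMonoOn hz.le).injOn hv hw (inv_injective h)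

lemma countable_levelSet (hϑ : IsPickandsMeasure ϑ) {z : ℝ} (hz : 0 < z) {D : Set ℝ}
    {D' : Set I} (hD : D.Countable) (hD' : D'.Countable) : (levelSet ϑ z D D').Countable := by
  have key : ∀ {s N : Set ℝ} {f : ℝ → ℝ}, InjOn f s → N.Countable → (s ∩ f ⁻¹' N).Countable :=
    fun {_ _ f} hf hN =>
      MapsTo.countable_of_injOn (f := f) (fun _ hw => hw.2) (hf.mono inter_subset_left) hN
  exact (key (injOn_inv_tailFunction hϑ hz) hD).union
    (key (strictAntiOn_div_add hz).injOn (hD'.image _))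

/-- The direction opposite to absolute continuity: null sets of mixing variables are pulled back to
levels through convex, strictly monotone functions. -/
lemma volume_levelSet (hϑ : IsPickandsMeasure ϑ) {z : ℝ} (hz : 0 < z) {D : Set ℝ}
    {D' : Set I} (hD : volume D = 0) (hD' : volume D' = 0) :
    volume (levelSet ϑ z D D') = 0 := by
  refine measure_union_null ?_ ?_
  · have h1 := volume_preimage_eq_zero_of_strictAntiOn isOpen_Ioi convexOn_inv_Ioi
      strictAntiOn_inv_Ioi hD
    refine measure_mono_null ?_ (volume_preimage_eq_zero_of_strictMonoOn
      (hϑ.isOpen_lt_tailFunction z) (hϑ.convexOn_tailFunction_lt z)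
      (hϑ.tailFunction_strictMonoOn hz.le) h1)
    exact fun w hw => ⟨hw.1, hz.trans hw.1.2, hw.2⟩
  · rw [unitInterval.volume_apply] at hD'
    exact volume_preimage_eq_zero_of_strictAntiOn isOpen_Ioi (convexOn_div_add hz)
      (strictAntiOn_div_add hz) hD'

lemma conditionalMeasure_levelSet_compl [IsProbabilityMeasure γ] (hϑ : IsPickandsMeasure ϑ)
    {z : ℝ} (hz : 0 < z) {D : Set ℝ} {D' : Set I} (hD : γ Dᶜ = 0) (hD' : ϑ D'ᶜ = 0) :
    conditionalMeasure γ ϑ z {p | levelPoint ϑ z p.1 p.2 ∈ (levelSet ϑ z D D')ᶜ} = 0 := by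
  refine conditionalMeasure_levelPoint_eq_zero hϑ hz (measure_mono_null ?_ hD)
    (measure_mono_null ?_ hD')
  · rintro _ ⟨w, ⟨hw, hw'⟩, rfl⟩ h
    exact hw (Or.inl ⟨hw', h⟩)
  · rintro s ⟨w, ⟨hw, hw'⟩, hs⟩ h
    exact hw (Or.inr ⟨hw', s, h, hs.symm⟩)

lemma conditionalLaw_compl_eq_zero [IsProbabilityMeasure γ] (hϑ : IsPickandsMeasure ϑ)
    {z : ℝ} (hz : 0 < z) {D : Set ℝ} {D' : Set I} (hD : γ Dᶜ = 0) (hD' : ϑ D'ᶜ = 0)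
    {G : Set I} (hG : MeasurableSet G) (hsub : unitGenerator γ '' levelSet ϑ z D D' ⊆ G) :
    conditionalLaw γ ϑ z Gᶜ = 0 :=
  conditionalLaw_eq_zero hϑ z hG.compl (measure_mono_null
    (fun _ hp hmem => hp (hsub ⟨_, hmem, rfl⟩)) (conditionalMeasure_levelSet_compl hϑ hz hD hD'))

lemma isDiscrete_conditionalLaw [IsProbabilityMeasure γ] (hϑ : IsPickandsMeasure ϑ) {z : ℝ}
    (hz : 0 < z) (hγd : IsDiscrete γ) (hϑd : IsDiscrete ϑ) :
    IsDiscrete (conditionalLaw γ ϑ z) := by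
  obtain ⟨D, hD, hγD⟩ := hγd
  obtain ⟨D', hD', hϑD⟩ := hϑd
  have hc := (countable_levelSet hϑ hz hD hD').image (unitGenerator γ)
  exact ⟨_, hc, conditionalLaw_compl_eq_zero hϑ hz hγD hϑD hc.measurableSet subset_rfl⟩

lemma isSingular_conditionalLaw (hγ : IsWilliamsonMeasure γ) (hϑ : IsPickandsMeasure ϑ) {z : ℝ}
    (hz : 0 < z) (h0 : conditionalLaw γ ϑ z {0} = 0) (hγs : IsSingular γ) (hϑs : IsSingular ϑ) :
    IsSingular (conditionalLaw γ ϑ z) := by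
  have := hγ.isProbabilityMeasure
  refine ⟨fun b => ?_, ?_⟩
  -- A value `b ≠ 0` comes from at most one positive level, and a level determines at most one `t`
  -- and one `s`, neither of which is an atom.
  · by_cases hb : b = 0
    · rwa [hb]
    have hsub := hγ.subsingleton_unitGenerator_preimage hb
    have key : ∀ {S : Type} [MeasurableSpace S] {ν : Measure S} {A : Set S},
        (∀ s, ν {s} = 0) → A.Subsingleton → ν A = 0 := fun hν hA => by
      rcases hA.eq_empty_or_singleton with rfl | ⟨a, rfl⟩
      exacts [measure_empty, hν a]
    exact conditionalLaw_eq_zero hϑ z (measurableSet_singleton b)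
      (conditionalMeasure_levelPoint_eq_zero (B := {w | unitGenerator γ w = b}) hϑ hz
        (key hγs.1 ((hsub.anti (inter_subset_inter_right _ fun w hw => hw.1)).image _))
        (key hϑs.1 ((hsub.image _).preimage Subtype.val_injective)))
  · obtain ⟨D, -, hD, hγD⟩ := hγs.2
    obtain ⟨D', -, hD', hϑD⟩ := hϑs.2
    have hnull := hγ.volume_unitGenerator_image (levelSet_subset z D D')
      (volume_levelSet hϑ hz hD hD')
    -- The image of the level set need not be Borel, hence the measurable hull of the same measure.
    exact ⟨toMeasurable volume (unitGenerator γ '' levelSet ϑ z D D'),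
      measurableSet_toMeasurable _ _, (measure_toMeasurable _).trans hnull, conditionalLaw_compl_eq_zero hϑ hz hγD hϑD
        (measurableSet_toMeasurable _ _) (subset_toMeasurable _ _)⟩

/-! ### Components of regular measures -/

lemma absPart_univ {ν : Measure I} [IsFiniteMeasure ν] (h : ν ≪ volume) :
    absPart ν univ = ν univ := by
  rw [absPart, Measure.withDensity_rnDeriv_eq _ _ h]

lemma disPart_univ {ν : Measure I} (h : IsDiscrete ν) : disPart ν univ = ν univ := by
  obtain ⟨D, hD, hν⟩ := h
  rw [disPart, Measure.restrict_apply_univ]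
  refine le_antisymm (measure_mono (subset_univ _)) ?_
  have hnull : ν {y | ν {y} ≠ 0}ᶜ = 0 := by
    -- The points of `D` that are not atoms form a countable union of null singletons.
    have h1 : ν (D ∩ {y | ν {y} = 0}) = 0 := by
      rw [← biUnion_of_singleton (D ∩ {y | ν {y} = 0})]
      exact (measure_biUnion_null_iff (hD.mono inter_subset_left)).2 fun y hy => hy.2
    refine measure_mono_null (fun y hy => ?_) (measure_union_null h1 hν)
    by_cases hyD : y ∈ D
    · exact Or.inl ⟨hyD, not_not.1 hy⟩
    · exact Or.inr hyD
  rw [← union_compl_self {y | ν {y} ≠ 0}]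
  exact (measure_union_le _ _).trans_eq (by rw [hnull, add_zero])

lemma singPart_univ {ν : Measure I} [IsFiniteMeasure ν] (h : IsSingular ν) :
    singPart ν univ = ν univ := by
  obtain ⟨hatom, G, hG, hG0, hν⟩ := h
  have hs : ν ⟂ₘ volume := ⟨Gᶜ, hG.compl, hν, by rwa [compl_compl]⟩
  have huniv : {y | ν {y} = 0} = univ := eq_univ_of_forall hatom
  rw [singPart, huniv, Measure.restrict_univ, Measure.singularPart_eq_self.2 hs]

lemma compProd_univ_eq_one {L : Kernel I I} [IsFiniteKernel L] (h : ∀ᵐ x, L x univ = 1) :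
    ((volume : Measure I) ⊗ₘ L) univ = 1 := by
  rw [← univ_prod_univ, Measure.compProd_apply_prod .univ .univ, Measure.restrict_univ,
    lintegral_congr_ae h]
  simp

/-- Almost every conditional law of the Archimax copula is one of the explicit laws. -/
lemma ae_markovKernel_archimaxCopula (hγ : IsWilliamsonMeasure γ) (hϑ : IsPickandsMeasure ϑ) :
    ∀ᵐ x, ∃ z, 0 < z ∧ markovKernel (archimaxCopula γ ϑ) x = conditionalLaw γ ϑ z ∧
      conditionalLaw γ ϑ z {0} = 0 := by
  filter_upwards [markovKernel_archimaxCopula hγ hϑ, archimaxKernel_singleton_zero hγ hϑ,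
    ae_mem_Ioo] with x hx hx0 hxI
  exact ⟨_, unitPseudoInverse_pos hγ hxI, hx.symm, hx0⟩

end Archimax

end

theorem mainTheorem4 (γ : MeasureTheory.Measure ℝ) (ϑ : MeasureTheory.Measure unitInterval)
    (hγ : Archimax.IsWilliamsonMeasure γ) (hϑ : Archimax.IsPickandsMeasure ϑ) :
    (γ.AbsolutelyContinuous MeasureTheory.volume → ϑ.AbsolutelyContinuous MeasureTheory.volume →
      Archimax.IsAbsolutelyContinuousCopula (Archimax.archimaxCopula γ ϑ)) ∧
    (Archimax.IsDiscrete γ → Archimax.IsDiscrete ϑ → ϑ {0} = 0 → ϑ {1} = 0 →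
      Archimax.IsDiscreteCopula (Archimax.archimaxCopula γ ϑ)) ∧
    (Archimax.IsSingular γ → Archimax.IsSingular ϑ →
      Archimax.IsSingularCopula (Archimax.archimaxCopula γ ϑ)) := by 
  refine ⟨fun hγac hϑac => ⟨Archimax.isCopula_archimaxCopula hγ hϑ, ?_⟩,
    fun hγd hϑd _ _ => ⟨Archimax.isCopula_archimaxCopula hγ hϑ, ?_⟩,
    fun hγs hϑs => ⟨Archimax.isCopula_archimaxCopula hγ hϑ, ?_⟩⟩
  -- Each component has mass one once almost every conditional law, a probability measure, is
  -- entirely of the required type.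
  all_goals
    refine Archimax.compProd_univ_eq_one ?_
    filter_upwards [Archimax.ae_markovKernel_archimaxCopula hγ hϑ] with x ⟨z, hz, hx, h0⟩
    have := hγ.isProbabilityMeasure
  · refine (Archimax.absPart_univ ?_).trans measure_univ
    rw [hx]
    exact Archimax.conditionalLaw_absolutelyContinuous hγ hϑ hz h0 hγac hϑac
  · refine (Archimax.disPart_univ ?_).trans measure_univ
    rw [hx]
    exact Archimax.isDiscrete_conditionalLaw hϑ hz hγd hϑd
  · refine (Archimax.singPart_univ ?_).trans measure_univ
    rw [hx]
    exact Archimax.isSingular_conditionalLaw hγ hϑ hz h0 hγs hϑs
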